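/- Let $n\ge 0$, and consider the following four sets. - $\mathcal S_n(321)$: the permutations $\pi$ of $\{1,\dots,n\}$ for which there are no $i<j<k$ with $\pi(i)>\pi(j)>\pi(k)$. - $\mathcal A(\mathbf A^{n-1})$: the antichains of the type $A$ positive root poset $\mathbf A^{n-1}=\{[i,j]:1\le i\le j\le n-1\}$, ordered by inclusion of intervals. - $\mathcal D_n$: the words with $n$ letters $u$ and $n$ letters $d$ such that every prefix contains at least as many $u$'s as $d$'s. - $\mathcal N_n$: the noncrossing perfect matchings of $\{1,\dots,2n\}$, i.e. those for which there are no $i<j<k<\ell$ with $i$ matched to $k$ and $j$ matched to $\ell$. The points $1,\dots,2n$ are placed in clockwise order around a circle, and $\overline{i}$ denotes $2n+1-i$ for $1\le i\le n$. Define four maps. - $\mathrm{Exc}:\mathcal S_n(321)\to\mathcal A(\mathbf A^{n-1})$ is given by $\mathrm{Exc}(\pi)=\{[i,\pi(i)-1] : \pi(i)>i\}$. - $\mathrm{RSKD}:\mathcal S_n(321)\to\mathcal D_n$. Let $(P,Q)$ be the insertion and recording tableaux of $\pi$ under the Robinson–Schensted–Knuth correspondence (row insertion of $\pi(1),\dots,\pi(n)$).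 For $1\le i\le n$, the $i$th step of $\mathrm{RSKD}(\pi)$ is $u$ if $i$ is in the top row of $P$ and $d$ otherwise, and its $(2n+1-i)$th step is $d$ if $i$ is in the top row of $Q$ and $u$ otherwise. - $\mathrm{Match}:\mathcal D_n\to\mathcal N_n$ matches $x$ and $y$ in $\mathrm{Match}(D)$ if the steps of $D$ in positions $x$ and $y$ form a tunnel, i.e. are matched with each other when $u$ and $d$ are read as opening and closing parentheses. - $\mathrm{AST}:\mathcal A(\mathbf A^{n-1})\to\mathcal N_n$ (the Armstrong–Stump–Thomas map). Starting with no arcs, perform the following step for $i=1,\dots,n$ in order: if $[i,j-1]\in A$ for some $j$, match the vertex $j$ with the nearest unmatched vertex in counterclockwise direction; otherwise match the vertex $\overline{i}$ with the nearest unmatched vertex in clockwise direction. Then $\mathrm{AST}(A)$ is the resulting matching. **Theorem.** These four maps are well-defined bijections between the indicated sets, and $$\mathrm{AST}=\mathrm{Match}\circ\mathrm{RSKD}\circ\mathrm{Exc}^{-1}.$$ -/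

import Mathlib

namespace ASTConnection

/-! ### Permutations avoiding 321, the positive root poset of type A, and `Exc` -/

/-- The set of 321-avoiding permutations. The letter `i` of `{1, …, n}` is the element of `Fin n`
with value `i - 1`. -/
def perms321 (n : ℕ) : Set (Equiv.Perm (Fin n)) :=
  {π | ¬ ∃ i j k : Fin n, i < j ∧ j < k ∧ π k < π j ∧ π j < π i}

/-- The positive root poset `A^m`: the intervals `[i, j]` with `1 ≤ i ≤ j ≤ m`, ordered by
inclusion (the order of `NonemptyInterval ℕ`). -/
def rootPoset (m : ℕ) : Set (NonemptyInterval ℕ) :=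
  {I | 1 ≤ I.fst ∧ I.snd ≤ m}

/-- The antichains of the poset `A^m`. -/
def antichains (m : ℕ) : Set (Finset (NonemptyInterval ℕ)) :=
  {A | (A : Set (NonemptyInterval ℕ)) ⊆ rootPoset m ∧
    IsAntichain (· ≤ ·) (A : Set (NonemptyInterval ℕ))}

/-- The interval `[i, π(i) - 1]` attached to an excedance `(i, π(i))`; in terms of the values in
`Fin n`, which are one less than the letters, this is `[i + 1, π i]`. -/
def excInterval {n : ℕ} (π : Equiv.Perm (Fin n)) (i : Fin n) (h : i < π i) :
    NonemptyInterval ℕ :=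
  ⟨((i : ℕ) + 1, (π i : ℕ)), h⟩

/-- `Exc π` is the set of the intervals `[i, π(i) - 1]` with `(i, π(i))` an excedance of `π`. -/
def Exc {n : ℕ} (π : Equiv.Perm (Fin n)) : Finset (NonemptyInterval ℕ) :=
  Finset.univ.image fun i : {i : Fin n // i < π i} => excInterval π i.1 i.2

/-! ### The Robinson–Schensted–Knuth correspondence

A tableau is the list of its rows, from top to bottom. -/

/-- Row insertion: `x` replaces the leftmost entry that is larger than `x`, and this entry is
returned; if there is none then `x` is put at the end of the row. -/
def rowInsert : List ℕ → ℕ → List ℕ × Option ℕ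
  | [], x => ([x], none)
  | y :: r, x =>
    if x < y then (x :: r, some y) else (y :: (rowInsert r x).1, (rowInsert r x).2)

/-- Insertion of `x` into a tableau: the entry bumped from a row is inserted into the next row.
The second component is the index (from 0) of the row in which the tableau grows. -/
def tabInsert : List (List ℕ) → ℕ → List (List ℕ) × ℕ
  | [], x => ([[x]], 0)
  | r :: T, x =>
    match rowInsert r x with
    | (r', none) => (r' :: T, 0)
    | (r', some y) => (r' :: (tabInsert T y).1, (tabInsert T y).2 + 1)

/-- Put the entry `k` at the end of the row with index `i` of a tableau. -/
def addToRow : List (List ℕ) → ℕ → ℕ → List (List ℕ)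
  | [], _, k => [[k]]
  | r :: T, 0, k => (r ++ [k]) :: T
  | r :: T, i + 1, k => r :: addToRow T i k

/-- One step of the correspondence: the `k`-th letter `x` is inserted into the insertion tableau
and `k` is put into the recording tableau at the place where the insertion tableau has grown. -/
def rskStep (PQ : List (List ℕ) × List (List ℕ)) (kx : ℕ × ℕ) :
    List (List ℕ) × List (List ℕ) :=
  ((tabInsert PQ.1 kx.2).1, addToRow PQ.2 (tabInsert PQ.1 kx.2).2 kx.1)

/-- `RSK π = (P, Q)`, the insertion tableau and the recording tableau of the word
`π(1) π(2) ⋯ π(n)` in the letters `1, …, n`. -/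
def RSK {n : ℕ} (π : Equiv.Perm (Fin n)) : List (List ℕ) × List (List ℕ) :=
  (List.ofFn fun i : Fin n => ((i : ℕ) + 1, (π i : ℕ) + 1)).foldl rskStep ([], [])

/-- The entries of the top row of a tableau. -/
def topRow (T : List (List ℕ)) : List ℕ := T.headD []

/-! ### Dyck paths -/

/-- The Dyck paths with `n` up steps and `n` down steps, as words. -/
def dyckPaths (n : ℕ) : Set (List DyckStep) :=
  {w | ∃ D : DyckWord, D.semilength = n ∧ D.toList = w}

/-- The path whose `i`-th step is `U` iff `i` is in the top row of `P` and whose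
`(2n + 1 - i)`-th step is `D` iff `i` is in the top row of `Q`, for `1 ≤ i ≤ n`. -/
def RSKD {n : ℕ} (π : Equiv.Perm (Fin n)) : List DyckStep :=
  ((List.range' 1 n).map fun i =>
      if i ∈ topRow (RSK π).1 then DyckStep.U else DyckStep.D) ++
    ((List.range' 1 n).map fun i =>
      if i ∈ topRow (RSK π).2 then DyckStep.D else DyckStep.U).reverse

/-! ### Noncrossing matchings

A matching of `{1, …, 2n}` is the set of its arcs, an arc with endpoints `x < y` being `(x, y)`. -/

/-- The noncrossing (perfect) matchings of `{1, …, 2n}`. -/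
def ncMatchings (n : ℕ) : Set (Finset (ℕ × ℕ)) :=
  {M | (∀ a ∈ M, 1 ≤ a.1 ∧ a.1 < a.2 ∧ a.2 ≤ 2 * n) ∧
    (∀ v, 1 ≤ v → v ≤ 2 * n → ∃! a, a ∈ M ∧ (a.1 = v ∨ a.2 = v)) ∧
    ¬ ∃ i j k l, i < j ∧ j < k ∧ k < l ∧ (i, k) ∈ M ∧ (j, l) ∈ M}

/-- The height of a path after `k` steps. -/
def height (w : List DyckStep) (k : ℕ) : ℤ :=
  ((w.take k).count DyckStep.U : ℤ) - ((w.take k).count DyckStep.D : ℤ)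

/-- The steps in positions `x < y` (from 1) form a tunnel: the horizontal segment from the lattice
point before step `x` to the lattice point after step `y` meets the path only in these two points
and is otherwise below the path. Equivalently, step `x` is an opening parenthesis and
step `y` is the closing parenthesis matched with it. -/
def IsTunnel (w : List DyckStep) (x y : ℕ) : Prop :=
  1 ≤ x ∧ x < y ∧ y ≤ w.length ∧ height w (x - 1) = height w y ∧
    ∀ z, x ≤ z → z < y → height w (x - 1) < height w z

open Classical in
/-- `Match w` joins the positions `x` and `y` when the steps of `w` there form a tunnel. -/
noncomputable def Match (w : List DyckStep) : Finset (ℕ × ℕ) :=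
  (Finset.Icc 1 w.length ×ˢ Finset.Icc 1 w.length).filter fun a => IsTunnel w a.1 a.2

/-! ### The Armstrong–Stump–Thomas map

The vertices `1, …, 2n` are placed around a circle in clockwise order. -/

/-- The next vertex in clockwise direction. -/
def cwNext (n v : ℕ) : ℕ := if v = 2 * n then 1 else v + 1

/-- The next vertex in counterclockwise direction. -/
def ccwNext (n v : ℕ) : ℕ := if v = 1 then 2 * n else v - 1

/-- The vertex `v` is not an endpoint of an arc of `M`. -/
def IsUnmatched (M : Finset (ℕ × ℕ)) (v : ℕ) : Prop := ∀ a ∈ M, a.1 ≠ v ∧ a.2 ≠ v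

instance (M : Finset (ℕ × ℕ)) (v : ℕ) : Decidable (IsUnmatched M v) := by
  unfold IsUnmatched; infer_instance

/-- Add to `M` the arc that joins the vertex `v` to the first unmatched vertex met when the
`2n - 1` vertices other than `v` are visited in the order `next v, next (next v), …`. -/
def matchNearest (n : ℕ) (next : ℕ → ℕ) (M : Finset (ℕ × ℕ)) (v : ℕ) : Finset (ℕ × ℕ) :=
  match (List.iterate next (next v) (2 * n - 1)).find? (fun u => IsUnmatched M u) with
  | some u => insert (min u v, max u v) M
  | none => M

/-- Step `i`: if `[i, j - 1] ∈ A` for some `j` (which is unique when `A` is an antichain) then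
match `j` with the nearest unmatched vertex in counterclockwise direction; otherwise match
`2n + 1 - i` with the nearest unmatched vertex in clockwise direction. -/
def astStep (n : ℕ) (A : Finset (NonemptyInterval ℕ)) (M : Finset (ℕ × ℕ)) (i : ℕ) :
    Finset (ℕ × ℕ) :=
  match (List.range' 1 n).find? (fun j => ∃ I ∈ A, I.fst = i ∧ I.snd + 1 = j) with
  | some j => matchNearest n (ccwNext n) M j
  | none => matchNearest n (cwNext n) M (2 * n + 1 - i)

/-- The Armstrong–Stump–Thomas map: start from no arcs and perform the steps `i = 1, …, n`. -/
def AST (n : ℕ) (A : Finset (NonemptyInterval ℕ)) : Finset (ℕ × ℕ) :=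
  (List.range' 1 n).foldl (astStep n A) ∅

end ASTConnection

/-!
All four sets are compared through the excedances of a 321-avoiding permutation `π`.

*Excedances.* In a 321-avoiding permutation every excedance is a left-to-right maximum and every
other position is a right-to-left minimum (`lt_of_lt_excedance`, `lt_of_not_excedance_lt`), so `π`
is increasing on the excedances and on their complement. Hence it is determined by the set `I` of
excedance positions and the set `J` of excedance values, and any two sets of the same size of which
`J` dominates `I` occur (`exists_perm321`). Antichains of intervals are determined by such pairs
too, through their left and right endpoints. So `Exc` is bijective.

*Row insertion.* Excedance values are appended to the top row, the other letters stay in it for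
ever, and each of the latter bumps the smallest larger entry, if there is one. The entries that are
bumped are therefore excedance values, and they leave the row in increasing order. It follows that
an excedance `(i, π i)` has its value bumped later iff `π i - i` is larger than the number `δ` of
entries that are in the row before time `i` and are bumped later
(`IsWord321.exc_not_mem_row_iff`).

*The Armstrong–Stump–Thomas map.* Call the vertices `1, …, n` values, and `2n + 1 - i` the time `i`.
After `k` steps exactly `2k` vertices are matched, none of them beyond the reach of these steps; of
the matched vertices `k + δ` are values, where `δ` is the number of entries in the top row after `k`
insertions that are bumped later (`ASTInvariant`). This count decides whether the next step reaches
a value or a time, and shows that every arc goes from an up step to a down step of `RSKD π`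
(`IsStep.isUp`). Since `AST` produces a noncrossing matching (an arc is only added between vertices
that no other arc separates, `IsPartialMatching.insert`), its arcs are the tunnels of `RSKD π`, and
`RSKD π` is a Dyck path (`Labels.Match_eq`, `Labels.mem_dyckPaths`).

*Bijectivity.* `Match` is inverted by reading off the left endpoints of the arcs. `AST` is
injective: at the first excedance where two permutations differ, the arcs from the smaller value (or
from the time) go in opposite directions (`ast_ne_of_lt`). So `RSKD` is injective, and it is
surjective by counting, because a Dyck path encodes in its steps a pair `(I, J)` as above
(`ncard_dyckPaths_le`).
-/

namespace ASTConnection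

/-! ### Heights of paths -/

lemma height_zero (w : List DyckStep) : height w 0 = 0 := by simp [height]

lemma height_succ_of_U {w : List DyckStep} {k : ℕ} (h : w[k]? = some DyckStep.U) :
    height w (k + 1) = height w k + 1 := by
  simp [height, List.take_add_one, h]; ring

lemma height_succ_of_D {w : List DyckStep} {k : ℕ} (h : w[k]? = some DyckStep.D) :
    height w (k + 1) = height w k - 1 := by
  simp [height, List.take_add_one, h]; ring

lemma getElem?_eq_U_or_D {w : List DyckStep} {k : ℕ} (h : k < w.length) :
    w[k]? = some DyckStep.U ∨ w[k]? = some DyckStep.D := by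
  rw [List.getElem?_eq_getElem h]
  cases w[k] <;> simp

lemma count_U_add_count_D (w : List DyckStep) :
    w.count DyckStep.U + w.count DyckStep.D = w.length := by
  induction w with
  | nil => rfl
  | cons a w ih => cases a <;> simp <;> omega

lemma mem_dyckPaths {n : ℕ} {w : List DyckStep} :
    w ∈ dyckPaths n ↔ w.length = 2 * n ∧ height w (2 * n) = 0 ∧
      ∀ k, k ≤ 2 * n → 0 ≤ height w k := by
  have hc := count_U_add_count_D w
  constructor
  · rintro ⟨D, hD, rfl⟩
    have h1 := D.count_U_eq_count_D
    have h2 : D.toList.count DyckStep.U = n := hD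
    have hl : D.toList.length = 2 * n := by omega
    refine ⟨hl, ?_, fun k _ => ?_⟩
    · rw [height, ← hl, List.take_length]; omega
    · have := D.count_D_le_count_U k
      rw [height]; omega
  · rintro ⟨hl, h0, hpos⟩
    rw [height, ← hl, List.take_length] at h0
    refine ⟨⟨w, by omega, fun i => ?_⟩, ?_, rfl⟩
    · rcases le_total i (2 * n) with h | h
      · have := hpos i h
        rw [height] at this; omega
      · rw [List.take_of_length_le (by omega)]; omega
    · change w.count DyckStep.U = n
      omega

/-! ### Tunnels -/

lemma IsTunnel.left_eq_U {w : List DyckStep} {x y : ℕ} (h : IsTunnel w x y) :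
    w[x - 1]? = some DyckStep.U := by
  obtain ⟨h1, h2, h3, h4, h5⟩ := h
  rcases getElem?_eq_U_or_D (w := w) (k := x - 1) (by omega) with h | h
  · exact h
  · have := height_succ_of_D h
    have := h5 x le_rfl h2
    rw [Nat.sub_add_cancel h1] at *
    omega

lemma IsTunnel.right_eq_D {w : List DyckStep} {x y : ℕ} (h : IsTunnel w x y) :
    w[y - 1]? = some DyckStep.D := by
  obtain ⟨h1, h2, h3, h4, h5⟩ := h
  rcases getElem?_eq_U_or_D (w := w) (k := y - 1) (by omega) with h | h
  · have := height_succ_of_U h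
    have := h5 (y - 1) (by omega) (by omega)
    rw [Nat.sub_add_cancel (by omega)] at *
    omega
  · exact h

lemma IsTunnel.right_unique {w : List DyckStep} {x y z : ℕ} (h : IsTunnel w x y)
    (h' : IsTunnel w x z) : y = z := by
  obtain ⟨h1, h2, h3, h4, h5⟩ := h
  obtain ⟨h1', h2', h3', h4', h5'⟩ := h'
  rcases lt_trichotomy y z with hyz | hyz | hyz
  · have := h5' y (by omega) hyz
    omega
  · exact hyz
  · have := h5 z (by omega) hyz
    omega

lemma IsTunnel.left_unique {w : List DyckStep} {x y z : ℕ} (h : IsTunnel w x z)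
    (h' : IsTunnel w y z) : x = y := by
  obtain ⟨h1, h2, h3, h4, h5⟩ := h
  obtain ⟨h1', h2', h3', h4', h5'⟩ := h'
  rcases lt_trichotomy x y with hyz | hyz | hyz
  · have := h5 (y - 1) (by omega) (by omega)
    omega
  · exact hyz
  · have := h5' (x - 1) (by omega) (by omega)
    omega

/-- The tunnel of an up step ends at the first return to the height before this step. -/
lemma IsTunnel.exists_of_U {n : ℕ} {w : List DyckStep} (hw : w ∈ dyckPaths n) {x : ℕ} (hx : 1 ≤ x)
    (h : w[x - 1]? = some DyckStep.U) : ∃ y, IsTunnel w x y := by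
  classical
  obtain ⟨hl, h0, hpos⟩ := mem_dyckPaths.1 hw
  have hxl : x - 1 < w.length := by
    by_contra hc
    rw [List.getElem?_eq_none (by omega)] at h; cases h
  have hs := height_succ_of_U h
  rw [Nat.sub_add_cancel hx] at hs
  have hne : ¬ (2 * n = x) := by
    rintro rfl
    have := hpos (2 * n - 1) (by omega)
    omega
  have hex : ∃ y, x ≤ y ∧ height w y ≤ height w (x - 1) :=
    ⟨2 * n, by omega, by rw [h0]; exact hpos _ (by omega)⟩
  obtain ⟨hy1, hy2⟩ := Nat.find_spec hex
  have hmin : ∀ z, x ≤ z → z < Nat.find hex → height w (x - 1) < height w z := fun z hz1 hz2 => by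
    have := Nat.find_min hex hz2
    push Not at this
    exact this hz1
  have hyle : Nat.find hex ≤ 2 * n :=
    Nat.find_min' hex ⟨by omega, by rw [h0]; exact hpos _ (by omega)⟩
  generalize Nat.find hex = y at *
  have hxy : x ≠ y := by rintro rfl; omega
  refine ⟨y, hx, by omega, by omega, ?_, hmin⟩
  have h1 := hmin (y - 1) (by omega) (by omega)
  rcases getElem?_eq_U_or_D (w := w) (k := y - 1) (by omega) with h | h
  · have := height_succ_of_U h
    rw [Nat.sub_add_cancel (by omega)] at this; omega
  · have := height_succ_of_D h
    rw [Nat.sub_add_cancel (by omega)] at this; omega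

/-- The tunnel of a down step starts at the last earlier visit of the height after this step. -/
lemma IsTunnel.exists_of_D {n : ℕ} {w : List DyckStep} (hw : w ∈ dyckPaths n) {y : ℕ} (hy : 1 ≤ y)
    (h : w[y - 1]? = some DyckStep.D) : ∃ x, IsTunnel w x y := by
  classical
  obtain ⟨hl, h0, hpos⟩ := mem_dyckPaths.1 hw
  have hyl : y - 1 < w.length := by
    by_contra hc
    rw [List.getElem?_eq_none (by omega)] at h; cases h
  have hs := height_succ_of_D h
  rw [Nat.sub_add_cancel hy] at hs
  have hP0 : height w 0 ≤ height w y := by rw [height_zero]; exact hpos _ (by omega)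
  have hspec := Nat.findGreatest_spec (P := fun m => height w m ≤ height w y)
    (Nat.zero_le (y - 1)) hP0
  have hle := Nat.findGreatest_le (P := fun m => height w m ≤ height w y) (y - 1)
  have hmax : ∀ z, Nat.findGreatest (fun m => height w m ≤ height w y) (y - 1) < z → z ≤ y - 1 →
      height w y < height w z := fun z h1 h2 => by
    have := Nat.findGreatest_is_greatest h1 h2
    omega
  generalize Nat.findGreatest (fun m => height w m ≤ height w y) (y - 1) = m at *
  have hmy : m ≠ y - 1 := by rintro rfl; omega
  have hm : height w m = height w y := by
    have h1 := hmax (m + 1) (by omega) (by omega)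
    rcases getElem?_eq_U_or_D (w := w) (k := m) (by omega) with h | h
    · have := height_succ_of_U h; omega
    · have := height_succ_of_D h; omega
  refine ⟨m + 1, by omega, by omega, by omega, by simpa using hm, fun z h1 h2 => ?_⟩
  have := hmax z (by omega) (by omega)
  simpa [hm] using this

lemma mem_Match {w : List DyckStep} {x y : ℕ} : (x, y) ∈ Match w ↔ IsTunnel w x y := by
  simp only [Match, Finset.mem_filter, Finset.mem_product, Finset.mem_Icc, and_iff_right_iff_imp]
  rintro ⟨h1, h2, h3, -⟩
  omega

lemma Match_mem_ncMatchings {n : ℕ} {w : List DyckStep} (hw : w ∈ dyckPaths n) :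
    Match w ∈ ncMatchings n := by
  have hl := (mem_dyckPaths.1 hw).1
  refine ⟨?_, ?_, ?_⟩
  · rintro ⟨x, y⟩ h
    obtain ⟨h1, h2, h3, -⟩ := mem_Match.1 h
    exact ⟨h1, h2, by omega⟩
  · intro v hv1 hv2
    rcases getElem?_eq_U_or_D (w := w) (k := v - 1) (by omega) with h | h
    · obtain ⟨y, hy⟩ := IsTunnel.exists_of_U hw hv1 h
      refine ⟨(v, y), ⟨mem_Match.2 hy, Or.inl rfl⟩, ?_⟩
      rintro ⟨a, b⟩ ⟨hab, rfl | rfl⟩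
      · rw [hy.right_unique (mem_Match.1 hab)]
      · have := (mem_Match.1 hab).right_eq_D
        simp_all
    · obtain ⟨x, hx⟩ := IsTunnel.exists_of_D hw hv1 h
      refine ⟨(x, v), ⟨mem_Match.2 hx, Or.inr rfl⟩, ?_⟩
      rintro ⟨a, b⟩ ⟨hab, rfl | rfl⟩
      · have := (mem_Match.1 hab).left_eq_U
        simp_all
      · rw [hx.left_unique (mem_Match.1 hab)]
  · rintro ⟨i, j, k, l, hij, hjk, hkl, h1, h2⟩
    obtain ⟨a1, a2, a3, a4, a5⟩ := mem_Match.1 h1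
    obtain ⟨b1, b2, b3, b4, b5⟩ := mem_Match.1 h2
    have := a5 (j - 1) (by omega) (by omega)
    have := b5 k (by omega) (by omega)
    omega

/-- The increment of the height counts the steps `U` minus the steps `D`. -/
lemma height_sub_height {w : List DyckStep} {a b : ℕ} (hab : a ≤ b) (hb : b ≤ w.length) :
    height w b - height w a =
      (((Finset.Ioc a b).filter fun m => w[m - 1]? = some DyckStep.U).card : ℤ) -
        ((Finset.Ioc a b).filter fun m => w[m - 1]? = some DyckStep.D).card := by
  induction b, hab using Nat.le_induction with
  | base => simp
  | succ b hab ih =>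
    have ih := ih (by omega)
    rw [← Finset.insert_Ioc_right_eq_Ioc_add_one hab, Finset.filter_insert, Finset.filter_insert]
    rcases getElem?_eq_U_or_D (w := w) (k := b) (by omega) with h | h
    · have := height_succ_of_U h
      simp [h]; omega
    · have := height_succ_of_D h
      simp [h]; omega

/-! ### Words that label a noncrossing matching -/

/-- `w` has `U` at the smaller and `D` at the larger endpoint of every arc of `M`. -/
def Labels (w : List DyckStep) (M : Finset (ℕ × ℕ)) : Prop :=
  ∀ a ∈ M, w[a.1 - 1]? = some DyckStep.U ∧ w[a.2 - 1]? = some DyckStep.D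

section Labels

variable {n : ℕ} {M : Finset (ℕ × ℕ)} {w : List DyckStep}

lemma arc_eq_of_common (hM : M ∈ ncMatchings n) {a b : ℕ × ℕ} {v : ℕ} (ha : a ∈ M) (hb : b ∈ M)
    (hav : a.1 = v ∨ a.2 = v) (hbv : b.1 = v ∨ b.2 = v) : a = b := by
  have h1 := hM.1 a ha
  exact (hM.2.1 v (by omega) (by omega)).unique ⟨ha, hav⟩ ⟨hb, hbv⟩

lemma Labels.exists_arc_of_D (hM : M ∈ ncMatchings n) (hw : Labels w M) {m : ℕ} (h1 : 1 ≤ m)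
    (h2 : m ≤ 2 * n) (hm : w[m - 1]? = some DyckStep.D) : ∃ x, (x, m) ∈ M := by
  obtain ⟨⟨x, y⟩, ⟨h, rfl | rfl⟩, -⟩ := hM.2.1 m h1 h2
  · have := (hw _ h).1; simp_all
  · exact ⟨x, h⟩

lemma Labels.exists_arc_of_U (hM : M ∈ ncMatchings n) (hw : Labels w M) {m : ℕ} (h1 : 1 ≤ m)
    (h2 : m ≤ 2 * n) (hm : w[m - 1]? = some DyckStep.U) : ∃ y, (m, y) ∈ M := by
  obtain ⟨⟨x, y⟩, ⟨h, rfl | rfl⟩, -⟩ := hM.2.1 m h1 h2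
  · exact ⟨y, h⟩
  · have := (hw _ h).2; simp_all

/-- If the arcs that end in `(a, b]` also start there, then the path does not go down. -/
lemma Labels.height_le (hM : M ∈ ncMatchings n) (hl : w.length = 2 * n) (hw : Labels w M)
    {a b : ℕ} (hab : a ≤ b) (hb : b ≤ 2 * n) (h : ∀ x m, (x, m) ∈ M → a < m → m ≤ b → a < x) :
    height w a ≤ height w b := by
  have key : ((Finset.Ioc a b).filter fun m => w[m - 1]? = some DyckStep.D).card ≤
      ((Finset.Ioc a b).filter fun m => w[m - 1]? = some DyckStep.U).card := by
    refine Finset.card_le_card_of_forall_subsingleton (fun m x => (x, m) ∈ M) ?_ ?_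
    · intro m hm
      simp only [Finset.mem_filter, Finset.mem_Ioc] at hm
      obtain ⟨x, hx⟩ := hw.exists_arc_of_D hM (by omega) (by omega) hm.2
      have h1 := (hM.1 _ hx).2.1
      have h2 := h x m hx hm.1.1 hm.1.2
      exact ⟨x, by simpa using ⟨⟨h2, by omega⟩, (hw _ hx).1⟩, hx⟩
    · rintro x - m ⟨-, hm⟩ m' ⟨-, hm'⟩
      have := arc_eq_of_common hM (v := x) hm hm' (Or.inl rfl) (Or.inl rfl)
      simpa using this
  have := height_sub_height hab (hl ▸ hb)
  omega

/-- If the arcs that start in `(a, b]` also end there, then the path does not go up. -/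
lemma Labels.le_height (hM : M ∈ ncMatchings n) (hl : w.length = 2 * n) (hw : Labels w M)
    {a b : ℕ} (hab : a ≤ b) (hb : b ≤ 2 * n) (h : ∀ m y, (m, y) ∈ M → a < m → m ≤ b → y ≤ b) :
    height w b ≤ height w a := by
  have key : ((Finset.Ioc a b).filter fun m => w[m - 1]? = some DyckStep.U).card ≤
      ((Finset.Ioc a b).filter fun m => w[m - 1]? = some DyckStep.D).card := by
    refine Finset.card_le_card_of_forall_subsingleton (fun m y => (m, y) ∈ M) ?_ ?_
    · intro m hm
      simp only [Finset.mem_filter, Finset.mem_Ioc] at hm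
      obtain ⟨x, hx⟩ := hw.exists_arc_of_U hM (by omega) (by omega) hm.2
      have h1 := (hM.1 _ hx).2.1
      have h2 := h m x hx hm.1.1 hm.1.2
      exact ⟨x, by simpa using ⟨⟨by omega, h2⟩, (hw _ hx).2⟩, hx⟩
    · rintro x - m ⟨-, hm⟩ m' ⟨-, hm'⟩
      have := arc_eq_of_common hM (v := x) hm hm' (Or.inr rfl) (Or.inr rfl)
      simpa using this
  have := height_sub_height hab (hl ▸ hb)
  omega

lemma Labels.isTunnel (hM : M ∈ ncMatchings n) (hl : w.length = 2 * n) (hw : Labels w M)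
    {x y : ℕ} (h : (x, y) ∈ M) : IsTunnel w x y := by
  obtain ⟨h1, h2, h3⟩ := hM.1 _ h
  simp only at h1 h2 h3
  have hx := height_succ_of_U (hw _ h).1
  have hy := height_succ_of_D (hw _ h).2
  simp only [Nat.sub_add_cancel h1] at hx
  rw [Nat.sub_add_cancel (by simp; omega)] at hy
  simp only at hy
  -- an arc ending strictly inside `(x, y)` starts there, as arcs do not cross
  have hin : ∀ x' m, (x', m) ∈ M → x < m → m < y → x < x' := by
    intro x' m hm hxm hmy
    rcases lt_trichotomy x x' with hlt | rfl | hlt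
    · exact hlt
    · have := arc_eq_of_common hM (v := x) h hm (Or.inl rfl) (Or.inl rfl)
      simp at this; omega
    · exact absurd ⟨x', x, m, y, hlt, hxm, hmy, hm, h⟩ hM.2.2
  have hout : ∀ m y', (m, y') ∈ M → x < m → m < y → y' < y := by
    intro m y' hm hxm hmy
    rcases lt_trichotomy y y' with hlt | rfl | hlt
    · exact absurd ⟨x, m, y, y', hxm, hmy, hlt, h, hm⟩ hM.2.2
    · have := arc_eq_of_common hM (v := y) h hm (Or.inr rfl) (Or.inr rfl)
      simp at this; omega
    · exact hlt
  have hup : ∀ z, x ≤ z → z < y → height w x ≤ height w z := fun z hz1 hz2 =>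
    hw.height_le hM hl hz1 (by omega) fun x' m hm a b => hin x' m hm a (by omega)
  have hdown : height w (y - 1) ≤ height w x :=
    hw.le_height hM hl (by omega) (by omega) fun m y' hm a b => by
      have := hout m y' hm a (by omega)
      omega
  have := hup (y - 1) (by omega) (by omega)
  refine ⟨h1, h2, by omega, by omega, fun z hz1 hz2 => ?_⟩
  have := hup z hz1 hz2
  omega

/-- A word that labels the arcs of a noncrossing matching is a Dyck path. -/
lemma Labels.mem_dyckPaths (hM : M ∈ ncMatchings n) (hl : w.length = 2 * n) (hw : Labels w M) :
    w ∈ dyckPaths n := by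
  have hpos : ∀ k, k ≤ 2 * n → 0 ≤ height w k := fun k hk => by
    rw [← height_zero w]
    exact hw.height_le hM hl (Nat.zero_le _) hk fun x m hm _ _ => (hM.1 _ hm).1
  refine ASTConnection.mem_dyckPaths.2 ⟨hl, le_antisymm ?_ (hpos _ le_rfl), hpos⟩
  rw [← height_zero w]
  exact hw.le_height hM hl (Nat.zero_le _) le_rfl fun m y hm _ _ => (hM.1 _ hm).2.2

/-- A noncrossing matching is recovered as the tunnels of any word that labels its arcs. -/
lemma Labels.Match_eq (hM : M ∈ ncMatchings n) (hl : w.length = 2 * n) (hw : Labels w M) :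
    Match w = M := by
  ext ⟨x, y⟩
  rw [mem_Match]
  refine ⟨fun h => ?_, fun h => hw.isTunnel hM hl h⟩
  obtain ⟨h1, h2, h3, -⟩ := id h
  obtain ⟨y', hy'⟩ := hw.exists_arc_of_U hM h1 (by omega) h.left_eq_U
  rwa [h.right_unique (hw.isTunnel hM hl hy')]

end Labels

theorem Match_bijOn (n : ℕ) : Set.BijOn Match (dyckPaths n) (ncMatchings n) := by
  classical
  refine ⟨fun w hw => Match_mem_ncMatchings hw, ?_, ?_⟩
  · intro w hw w' hw' h
    have hl := (mem_dyckPaths.1 hw).1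
    have hl' := (mem_dyckPaths.1 hw').1
    refine List.ext_getElem? fun k => ?_
    by_cases hk : k < 2 * n
    · rcases getElem?_eq_U_or_D (w := w) (k := k) (by omega) with hU | hD
      · obtain ⟨y, hy⟩ := IsTunnel.exists_of_U hw (x := k + 1) (by omega) (by simpa using hU)
        have := (mem_Match.1 (h ▸ mem_Match.2 hy)).left_eq_U
        rw [hU]; simpa using this.symm
      · obtain ⟨y, hy⟩ := IsTunnel.exists_of_D hw (y := k + 1) (by omega) (by simpa using hD)
        have := (mem_Match.1 (h ▸ mem_Match.2 hy)).right_eq_D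
        rw [hD]; simpa using this.symm
    · rw [List.getElem?_eq_none (by omega), List.getElem?_eq_none (by omega)]
  · intro M hM
    let w : List DyckStep := (List.range (2 * n)).map fun k =>
      if ∃ y, (k + 1, y) ∈ M then DyckStep.U else DyckStep.D
    have hl : w.length = 2 * n := by simp [w]
    have hw : Labels w M := by
      rintro ⟨x, y⟩ h
      obtain ⟨h1, h2, h3⟩ := hM.1 _ h
      simp only at h1 h2 h3
      have hy : ¬ ∃ z, (y, z) ∈ M := by
        rintro ⟨z, hz⟩
        have := arc_eq_of_common hM (v := y) h hz (Or.inr rfl) (Or.inl rfl)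
        simp at this; omega
      have e1 : x - 1 + 1 = x := by omega
      have e2 : y - 1 + 1 = y := by omega
      constructor
      · simp only [w, List.getElem?_map, List.getElem?_range (show x - 1 < 2 * n by omega),
          Option.map_some, e1, if_pos (⟨y, h⟩ : ∃ y, (x, y) ∈ M)]
      · simp only [w, List.getElem?_map, List.getElem?_range (show y - 1 < 2 * n by omega),
          Option.map_some, e2, if_neg hy]
    exact ⟨w, hw.mem_dyckPaths hM hl, hw.Match_eq hM hl⟩

/-! ### Excedances of 321-avoiding permutations -/

section Excedances

variable {n : ℕ} {π σ : Equiv.Perm (Fin n)}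

/-- An excedance of a 321-avoiding permutation is a left-to-right maximum: by the pigeonhole
principle some later value is smaller. -/
lemma lt_of_lt_excedance (hπ : π ∈ perms321 n) {i j : Fin n} (hi : i < π i) (hji : j < i) :
    π j < π i := by
  by_contra hlt
  have hne : π j ≠ π i := fun h => hji.ne (π.injective h)
  have hlt : π i < π j := lt_of_le_of_ne (not_lt.1 hlt) hne.symm
  have hall : ∀ k, π k < π i → k < i := fun k hk => by
    rcases lt_trichotomy k i with h | rfl | h
    · exact h
    · exact absurd hk (lt_irrefl _)
    · exact absurd ⟨j, i, k, hji, h, hk, hlt⟩ hπ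
  have hcard : (Finset.Iio (π i)).card ≤ (Finset.Iio i).card :=
    Finset.card_le_card_of_injOn π.symm
      (fun v hv => by
        simp only [Finset.coe_Iio, Set.mem_Iio] at hv ⊢
        exact hall _ (by simpa using hv)) π.symm.injective.injOn
  simp only [Fin.card_Iio] at hcard
  exact absurd hi (not_lt.2 hcard)

/-- A position that is not an excedance of a 321-avoiding permutation is a right-to-left
minimum. -/
lemma lt_of_not_excedance_lt (hπ : π ∈ perms321 n) {i k : Fin n} (hi : π i ≤ i) (hik : i < k) :
    π i < π k := by
  by_contra hlt
  have hne : π k ≠ π i := fun h => hik.ne' (π.injective h)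
  have hlt : π k < π i := lt_of_le_of_ne (not_lt.1 hlt) hne
  have hall : ∀ m, π i < π m → i < m := fun m hm => by
    rcases lt_trichotomy m i with h | rfl | h
    · exact absurd ⟨m, i, k, h, hik, hlt, hm⟩ hπ
    · exact absurd hm (lt_irrefl _)
    · exact h
  have hcard : (Finset.Ioi (π i)).card ≤ ((Finset.Ioi i).erase k).card :=
    Finset.card_le_card_of_injOn π.symm
      (fun v hv => by
        simp only [Finset.coe_Ioi, Set.mem_Ioi] at hv
        simp only [Finset.coe_erase, Finset.coe_Ioi, Set.mem_sdiff, Set.mem_Ioi,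
          Set.mem_singleton_iff]
        refine ⟨hall _ (by simpa using hv), ?_⟩
        rintro rfl
        simp only [Equiv.apply_symm_apply] at hlt
        exact absurd hv (not_lt.2 hlt.le)) π.symm.injective.injOn
  rw [Finset.card_erase_of_mem (by simpa using hik), Fin.card_Ioi, Fin.card_Ioi] at hcard
  have := Fin.le_def.1 hi
  have := k.isLt
  have := Fin.lt_def.1 hik
  omega

lemma mem_Exc {I : NonemptyInterval ℕ} :
    I ∈ Exc π ↔ ∃ i : Fin n, i < π i ∧ I.fst = i + 1 ∧ I.snd = π i := by
  simp only [Exc, Finset.mem_image, Finset.mem_univ, true_and, Subtype.exists, excInterval]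
  constructor
  · rintro ⟨i, hi, rfl⟩
    exact ⟨i, hi, rfl, rfl⟩
  · rintro ⟨i, hi, h1, h2⟩
    exact ⟨i, hi, NonemptyInterval.ext (by ext <;> simp [h1, h2])⟩

lemma Exc_mem_antichains (hπ : π ∈ perms321 n) : Exc π ∈ antichains (n - 1) := by
  refine ⟨fun I hI => ?_, fun I hI J hJ hne hle => hne ?_⟩
  · obtain ⟨i, hi, h1, h2⟩ := mem_Exc.1 hI
    exact ⟨by omega, by omega⟩
  · obtain ⟨i, hi, h1, h2⟩ := mem_Exc.1 hI
    obtain ⟨j, hj, h3, h4⟩ := mem_Exc.1 hJ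
    obtain ⟨h5, h6⟩ := NonemptyInterval.le_def.1 hle
    rcases lt_trichotomy i j with h | rfl | h
    · rw [Fin.lt_def] at h; omega
    · exact NonemptyInterval.ext (by ext <;> simp [*])
    · have := lt_of_lt_excedance hπ hi h
      rw [Fin.lt_def] at this; omega

lemma Exc_eq_iff : Exc π = Exc σ ↔ ∀ i, (i < π i ↔ i < σ i) ∧ (i < π i → π i = σ i) := by
  have key : ∀ {π σ : Equiv.Perm (Fin n)}, Exc π = Exc σ → ∀ i, i < π i → π i = σ i := by
    intro π σ h i hi
    have : excInterval π i hi ∈ Exc σ := h ▸ mem_Exc.2 ⟨i, hi, rfl, rfl⟩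
    obtain ⟨j, hj, h1, h2⟩ := mem_Exc.1 this
    simp only [excInterval] at h1 h2
    have : i = j := Fin.ext (by omega)
    subst this
    exact Fin.ext h2
  constructor
  · intro h i
    refine ⟨⟨fun hi => ?_, fun hi => ?_⟩, key h i⟩
    · rwa [← key h i hi]
    · rwa [← key h.symm i hi]
  · intro h
    ext I
    rw [mem_Exc, mem_Exc]
    constructor
    · rintro ⟨i, hi, h1, h2⟩
      exact ⟨i, (h i).1.1 hi, h1, by rw [h2, (h i).2 hi]⟩
    · rintro ⟨i, hi, h1, h2⟩
      have hi' := (h i).1.2 hi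
      exact ⟨i, hi', h1, by rw [h2, (h i).2 hi']⟩

lemma Exc_injOn (n : ℕ) : Set.InjOn (Exc (n := n)) (perms321 n) := by
  intro π hπ σ hσ h
  rw [Exc_eq_iff] at h
  -- both permutations are increasing on the common set of non-excedances, with the same image
  let f : {i // ¬ i < π i} → Fin n := fun i => π i
  let g : {i // ¬ i < π i} → Fin n := fun i => σ i
  have hf : StrictMono f := fun i j hij => lt_of_not_excedance_lt hπ (not_lt.1 i.2) hij
  have hg : StrictMono g := fun i j hij =>
    lt_of_not_excedance_lt hσ (not_lt.1 (mt (h i).1.2 i.2)) hij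
  have hrange : Set.range f = Set.range g := by
    ext v
    constructor
    · rintro ⟨⟨i, hi⟩, rfl⟩
      refine ⟨⟨σ.symm (π i), fun hc => hi ?_⟩, by simp [f, g]⟩
      have h1 := (h _).2 hc
      rw [Equiv.apply_symm_apply, π.injective.eq_iff] at h1
      rwa [h1] at hc
    · rintro ⟨⟨i, hi⟩, rfl⟩
      refine ⟨⟨π.symm (σ i), fun hc => hi ?_⟩, by simp [f, g]⟩
      have h1 := (h _).2 hc
      rw [Equiv.apply_symm_apply, σ.injective.eq_iff] at h1
      rwa [← h1] at hc
  have hfg := (hf.range_inj hg).1 hrange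
  ext i
  by_cases hi : i < π i
  · rw [(h i).2 hi]
  · exact congrArg Fin.val (congrFun hfg ⟨i, hi⟩)

/-- An order isomorphism preserves the rank of an element. -/
lemma card_filter_le_orderIso {s t : Set (Fin n)} [DecidablePred (· ∈ s)] [DecidablePred (· ∈ t)]
    (e : s ≃o t) (x : s) :
    (Finset.univ.filter fun v => v ∈ t ∧ v ≤ e x).card =
      (Finset.univ.filter fun v => v ∈ s ∧ v ≤ x).card := by
  symm
  refine Finset.card_bij (fun v hv => e ⟨v, (Finset.mem_filter.1 hv).2.1⟩) ?_ ?_ ?_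
  · intro v hv
    simp only [Finset.mem_filter, Finset.mem_univ, true_and] at hv ⊢
    exact ⟨(e _).2, by rw [Subtype.coe_le_coe, e.le_iff_le]; exact hv.2⟩
  · intro v hv w hw h
    simpa using e.injective (Subtype.ext h)
  · intro v hv
    simp only [Finset.mem_filter, Finset.mem_univ, true_and] at hv
    refine ⟨e.symm ⟨v, hv.1⟩, ?_, by simp⟩
    simp only [Finset.mem_filter, Finset.mem_univ, true_and]
    refine ⟨(e.symm _).2, ?_⟩
    rw [Subtype.coe_le_coe, e.symm_apply_le]
    exact hv.2

/-- Positions `I` and values `J` of the same number, such that the `k`-th smallest element of `I`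
is less than the `k`-th smallest element of `J`, are the excedance positions and the excedance
values of a 321-avoiding permutation. -/
lemma exists_perm321 (I J : Finset (Fin n)) (hcard : I.card = J.card)
    (hdom : ∀ t, (J.filter (· ≤ t)).card ≤ (I.filter (· < t)).card) :
    ∃ π ∈ perms321 n, ∀ i, (i < π i ↔ i ∈ I) ∧ (π i ∈ J ↔ i ∈ I) := by
  have hcardc : Iᶜ.card = Jᶜ.card := by rw [Finset.card_compl, Finset.card_compl, hcard]
  let e : {x // x ∈ I} ≃o {x // x ∈ J} :=
    (I.orderIsoOfFin rfl).symm.trans (J.orderIsoOfFin hcard.symm)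
  let e' : {x // x ∈ Iᶜ} ≃o {x // x ∈ Jᶜ} :=
    (Iᶜ.orderIsoOfFin rfl).symm.trans (Jᶜ.orderIsoOfFin hcardc.symm)
  let f : Fin n → Fin n := fun x =>
    if h : x ∈ I then e ⟨x, h⟩ else e' ⟨x, Finset.mem_compl.2 h⟩
  have f_mem : ∀ {x} (h : x ∈ I), f x = e ⟨x, h⟩ := fun h => by simp [f, h]
  have f_not_mem : ∀ {x} (h : x ∉ I), f x = e' ⟨x, Finset.mem_compl.2 h⟩ := fun h => by
    simp [f, h]
  have fJ : ∀ x, f x ∈ J ↔ x ∈ I := fun x => by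
    by_cases h : x ∈ I
    · simp [f_mem h, h]
    · simpa [f_not_mem h, h] using Finset.mem_compl.1 (e' ⟨x, Finset.mem_compl.2 h⟩).2
  have hmono : ∀ x y, (x ∈ I ↔ y ∈ I) → x < y → f x < f y := fun x y h hxy => by
    by_cases hx : x ∈ I
    · rw [f_mem hx, f_mem (h.1 hx), Subtype.coe_lt_coe, e.lt_iff_lt]
      exact hxy
    · rw [f_not_mem hx, f_not_mem (mt h.2 hx), Subtype.coe_lt_coe, e'.lt_iff_lt]
      exact hxy
  have hinj : Function.Injective f := fun x y h => by
    have hIff : x ∈ I ↔ y ∈ I := by rw [← fJ x, ← fJ y, h]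
    rcases lt_trichotomy x y with hlt | heq | hlt
    · exact absurd h (hmono _ _ hIff hlt).ne
    · exact heq
    · exact absurd h (hmono _ _ hIff.symm hlt).ne'
  refine ⟨Equiv.ofBijective f (Finite.injective_iff_bijective.1 hinj), ?_, fun i => ⟨?_, fJ i⟩⟩
  · rintro ⟨i, j, k, hij, hjk, h1, h2⟩
    simp only [Equiv.ofBijective_apply] at h1 h2
    have a1 : ¬ (i ∈ I ↔ j ∈ I) := fun h => absurd (hmono _ _ h hij) h2.asymm
    have a2 : ¬ (j ∈ I ↔ k ∈ I) := fun h => absurd (hmono _ _ h hjk) h1.asymm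
    have a3 : ¬ (i ∈ I ↔ k ∈ I) := fun h =>
      absurd (hmono _ _ h (hij.trans hjk)) (h1.trans h2).asymm
    tauto
  · rw [Equiv.ofBijective_apply]
    constructor
    · intro hlt
      by_contra hi
      have hr := card_filter_le_orderIso (s := {x | x ∈ Iᶜ}) (t := {x | x ∈ Jᶜ}) e'
        ⟨i, Finset.mem_compl.2 hi⟩
      rw [← f_not_mem hi] at hr
      simp only [Set.mem_ofPred_eq, Finset.mem_compl] at hr
      have hd := hdom i
      have hs : (I.filter (· < i)).card + (Finset.univ.filter fun v => v ∉ I ∧ v ≤ i).card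
          = (Finset.Iic i).card := by
        rw [← Finset.card_union_of_disjoint]
        · congr 1
          ext v
          simp only [Finset.mem_union, Finset.mem_filter, Finset.mem_univ, true_and,
            Finset.mem_Iic]
          by_cases hv : v ∈ I
          · have : v ≠ i := fun h => hi (h ▸ hv)
            simp [hv, lt_iff_le_and_ne, this]
          · simp [hv]
        · rw [Finset.disjoint_left]
          intro v hv hv'
          simp only [Finset.mem_filter] at hv hv'
          exact hv'.2.1 hv.1
      have hs' : (J.filter (· ≤ i)).card + (Finset.univ.filter fun v => v ∉ J ∧ v ≤ i).card
          = (Finset.Iic i).card := by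
        rw [← Finset.card_union_of_disjoint]
        · congr 1
          ext v
          simp only [Finset.mem_union, Finset.mem_filter, Finset.mem_univ, true_and,
            Finset.mem_Iic]
          by_cases hv : v ∈ J <;> simp [hv]
        · rw [Finset.disjoint_left]
          intro v hv hv'
          simp only [Finset.mem_filter] at hv hv'
          exact hv'.2.1 hv.1
      have hlt' : (Finset.univ.filter fun v => v ∉ J ∧ v ≤ i).card <
          (Finset.univ.filter fun v => v ∉ J ∧ v ≤ f i).card := by
        refine Finset.card_lt_card (Finset.ssubset_iff.2 ⟨f i, ?_, ?_⟩)
        · simp [hlt]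
        · intro v hv
          simp only [Finset.mem_insert, Finset.mem_filter, Finset.mem_univ, true_and] at hv ⊢
          rcases hv with rfl | ⟨h1, h2⟩
          · exact ⟨mt (fJ i).1 hi, le_rfl⟩
          · exact ⟨h1, h2.trans hlt.le⟩
      omega
    · intro hi
      by_contra hlt
      rw [not_lt] at hlt
      have hr := card_filter_le_orderIso (s := {x | x ∈ I}) (t := {x | x ∈ J}) e ⟨i, hi⟩
      rw [← f_mem hi] at hr
      simp only [Set.mem_ofPred_eq] at hr
      have hd := hdom (f i)
      have h1 : (I.filter (· < f i)).card < (Finset.univ.filter fun v => v ∈ I ∧ v ≤ i).card := by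
        refine Finset.card_lt_card (Finset.ssubset_iff.2 ⟨i, ?_, ?_⟩)
        · simp [hlt]
        · intro v hv
          simp only [Finset.mem_insert, Finset.mem_filter, Finset.mem_univ, true_and] at hv ⊢
          rcases hv with rfl | ⟨h1, h2⟩
          · exact ⟨hi, le_rfl⟩
          · exact ⟨h1, h2.le.trans hlt⟩
      have h2 : (J.filter (· ≤ f i)) = Finset.univ.filter fun v => v ∈ J ∧ v ≤ f i := by
        ext v; simp
      rw [h2] at hd
      omega

lemma antichain_fst_le_iff {m : ℕ} {A : Finset (NonemptyInterval ℕ)} (hA : A ∈ antichains m)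
    {a b : NonemptyInterval ℕ} (ha : a ∈ A) (hb : b ∈ A) : a.fst ≤ b.fst ↔ a.snd ≤ b.snd := by
  have key : ∀ {a b : NonemptyInterval ℕ}, a ∈ A → b ∈ A → b.fst ≤ a.fst → a.snd ≤ b.snd →
      a = b := fun {a b} ha hb h1 h2 => by
    by_contra hne
    exact hA.2 ha hb hne (NonemptyInterval.le_def.2 ⟨h1, h2⟩)
  constructor
  · intro h
    by_contra hc
    have := key hb ha h (by omega)
    rw [this] at hc; omega
  · intro h
    by_contra hc
    have := key ha hb (by omega) h
    rw [this] at hc; omega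

lemma antichain_eq_of_fst_eq {m : ℕ} {A : Finset (NonemptyInterval ℕ)} (hA : A ∈ antichains m)
    {a b : NonemptyInterval ℕ} (ha : a ∈ A) (hb : b ∈ A) (h : a.fst = b.fst) : a = b := by
  have h1 := (antichain_fst_le_iff hA ha hb).1 h.le
  have h2 := (antichain_fst_le_iff hA hb ha).1 h.ge
  exact NonemptyInterval.ext (Prod.ext h (le_antisymm h1 h2))

lemma antichain_eq_of_snd_eq {m : ℕ} {A : Finset (NonemptyInterval ℕ)} (hA : A ∈ antichains m)
    {a b : NonemptyInterval ℕ} (ha : a ∈ A) (hb : b ∈ A) (h : a.snd = b.snd) : a = b := by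
  have h1 := (antichain_fst_le_iff hA ha hb).2 h.le
  have h2 := (antichain_fst_le_iff hA hb ha).2 h.ge
  exact NonemptyInterval.ext (Prod.ext (le_antisymm h1 h2) h)

/-- An antichain of intervals is determined by the left endpoints and the right endpoints, as it
joins the `k`-th smallest ones of both. -/
lemma antichain_subset_of_image_eq {m m' : ℕ} {A B : Finset (NonemptyInterval ℕ)}
    (hA : A ∈ antichains m) (hB : B ∈ antichains m')
    (h1 : A.image (·.fst) = B.image (·.fst)) (h2 : A.image (·.snd) = B.image (·.snd)) : A ⊆ B := by
  have rank : ∀ {k : ℕ} {C : Finset (NonemptyInterval ℕ)}, C ∈ antichains k → ∀ c ∈ C,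
      ((C.image (·.fst)).filter (· ≤ c.fst)).card =
        ((C.image (·.snd)).filter (· ≤ c.snd)).card := fun {k C} hC c hc => by
    rw [Finset.filter_image, Finset.filter_image, Finset.card_image_of_injOn,
      Finset.card_image_of_injOn]
    · congr 1
      refine Finset.filter_congr fun a ha => antichain_fst_le_iff hC ha hc
    · intro a ha b hb
      exact antichain_eq_of_snd_eq hC (Finset.mem_filter.1 ha).1 (Finset.mem_filter.1 hb).1
    · intro a ha b hb
      exact antichain_eq_of_fst_eq hC (Finset.mem_filter.1 ha).1 (Finset.mem_filter.1 hb).1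
  have strict : ∀ {s : Finset ℕ} {x y : ℕ}, y ∈ s → x < y →
      (s.filter (· ≤ x)).card < (s.filter (· ≤ y)).card := fun {s x y} hy hxy => by
    refine Finset.card_lt_card (Finset.ssubset_iff.2 ⟨y, by simp [hxy], fun v hv => ?_⟩)
    simp only [Finset.mem_insert, Finset.mem_filter] at hv ⊢
    rcases hv with rfl | ⟨h1, h2⟩
    · exact ⟨hy, le_rfl⟩
    · exact ⟨h1, h2.trans hxy.le⟩
  intro a ha
  obtain ⟨b, hb, hab⟩ := Finset.mem_image.1 (h1 ▸ Finset.mem_image_of_mem _ ha)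
  have r1 := rank hA a ha
  have r2 := rank hB b hb
  rw [hab, ← h1, r1, ← h2] at r2
  have : a.snd = b.snd := by
    rcases lt_trichotomy a.snd b.snd with h | h | h
    · exact absurd r2 (strict (h2 ▸ Finset.mem_image_of_mem _ hb) h).ne
    · exact h
    · exact absurd r2 (strict (Finset.mem_image_of_mem _ ha) h).ne'
  have : a = b := NonemptyInterval.ext (Prod.ext hab.symm this)
  rwa [this]

lemma Exc_surjOn (n : ℕ) : Set.SurjOn (Exc (n := n)) (perms321 n) (antichains (n - 1)) := by
  intro A hA
  have hr : ∀ a ∈ A, 1 ≤ a.fst ∧ a.fst ≤ a.snd ∧ a.snd < n := fun a ha => by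
    have := hA.1 ha
    have h1 := this.1
    have h2 := this.2
    have h3 := a.fst_le_snd
    exact ⟨h1, h3, by omega⟩
  let I : Finset (Fin n) := Finset.univ.filter fun i => ∃ a ∈ A, a.fst = i + 1
  let J : Finset (Fin n) := Finset.univ.filter fun j => ∃ a ∈ A, a.snd = j
  have cardI : ∀ t : Fin n, (I.filter (· < t)).card =
      (A.filter fun a => a.fst ≤ (t : ℕ)).card := fun t => by
    symm
    refine Finset.card_bij (fun a ha => ⟨a.fst - 1, ?_⟩) ?_ ?_ ?_
    · have := hr a (Finset.mem_filter.1 ha).1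
      omega
    · intro a ha
      obtain ⟨ha, hat⟩ := Finset.mem_filter.1 ha
      have := hr a ha
      simp only [I, Finset.mem_filter, Finset.mem_univ, true_and, Fin.lt_def]
      exact ⟨⟨a, ha, by omega⟩, by omega⟩
    · intro a ha b hb h
      obtain ⟨ha, hat⟩ := Finset.mem_filter.1 ha
      obtain ⟨hb, hbt⟩ := Finset.mem_filter.1 hb
      have := hr a ha
      have := hr b hb
      simp only [Fin.mk.injEq] at h
      exact antichain_eq_of_fst_eq hA ha hb (by omega)
    · intro i hi
      simp only [I, Finset.mem_filter, Finset.mem_univ, true_and, Fin.lt_def] at hi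
      obtain ⟨⟨a, ha, h⟩, hit⟩ := hi
      exact ⟨a, Finset.mem_filter.2 ⟨ha, by omega⟩, Fin.ext (by simp; omega)⟩
  have cardI' : I.card = A.card := by
    symm
    refine Finset.card_bij (fun a ha => ⟨a.fst - 1, ?_⟩) ?_ ?_ ?_
    · have := hr a ha
      omega
    · intro a ha
      have := hr a ha
      simp only [I, Finset.mem_filter, Finset.mem_univ, true_and]
      exact ⟨a, ha, by omega⟩
    · intro a ha b hb h
      have := hr a ha
      have := hr b hb
      simp only [Fin.mk.injEq] at h
      exact antichain_eq_of_fst_eq hA ha hb (by omega)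
    · intro i hi
      simp only [I, Finset.mem_filter, Finset.mem_univ, true_and] at hi
      obtain ⟨a, ha, h⟩ := hi
      exact ⟨a, ha, Fin.ext (by simp; omega)⟩
  have cardJ : ∀ t : Fin n, (J.filter (· ≤ t)).card =
      (A.filter fun a => a.snd ≤ (t : ℕ)).card := fun t => by
    symm
    refine Finset.card_bij (fun a ha => ⟨a.snd, (hr a (Finset.mem_filter.1 ha).1).2.2⟩) ?_ ?_ ?_
    · intro a ha
      obtain ⟨ha, hat⟩ := Finset.mem_filter.1 ha
      simp only [J, Finset.mem_filter, Finset.mem_univ, true_and, Fin.le_def]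
      exact ⟨⟨a, ha, rfl⟩, hat⟩
    · intro a ha b hb h
      simp only [Fin.mk.injEq] at h
      exact antichain_eq_of_snd_eq hA (Finset.mem_filter.1 ha).1 (Finset.mem_filter.1 hb).1 h
    · intro i hi
      simp only [J, Finset.mem_filter, Finset.mem_univ, true_and, Fin.le_def] at hi
      obtain ⟨⟨a, ha, h⟩, hit⟩ := hi
      exact ⟨a, Finset.mem_filter.2 ⟨ha, by omega⟩, Fin.ext h⟩
  have cardJ' : J.card = A.card := by
    symm
    refine Finset.card_bij (fun a ha => ⟨a.snd, (hr a ha).2.2⟩) ?_ ?_ ?_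
    · intro a ha
      simp only [J, Finset.mem_filter, Finset.mem_univ, true_and]
      exact ⟨a, ha, rfl⟩
    · intro a ha b hb h
      simp only [Fin.mk.injEq] at h
      exact antichain_eq_of_snd_eq hA ha hb h
    · intro i hi
      simp only [J, Finset.mem_filter, Finset.mem_univ, true_and] at hi
      obtain ⟨a, ha, h⟩ := hi
      exact ⟨a, ha, Fin.ext h⟩
  obtain ⟨π, hπ, hIJ⟩ := exists_perm321 I J (by rw [cardI', cardJ']) fun t => by
    rw [cardI, cardJ]
    refine Finset.card_le_card fun a ha => ?_
    simp only [Finset.mem_filter] at ha ⊢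
    have := hr a ha.1
    exact ⟨ha.1, by omega⟩
  have e1 : (Exc π).image (·.fst) = A.image (·.fst) := by
    ext v
    simp only [Finset.mem_image]
    constructor
    · rintro ⟨a, ha, rfl⟩
      obtain ⟨i, hi, h1, h2⟩ := mem_Exc.1 ha
      have := (hIJ i).1.1 hi
      simp only [I, Finset.mem_filter, Finset.mem_univ, true_and] at this
      obtain ⟨b, hb, hb'⟩ := this
      exact ⟨b, hb, by omega⟩
    · rintro ⟨a, ha, rfl⟩
      have := hr a ha
      have hi := (hIJ ⟨a.fst - 1, by omega⟩).1.2
        (by simp only [I, Finset.mem_filter, Finset.mem_univ, true_and]; exact ⟨a, ha, by omega⟩)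
      exact ⟨excInterval π _ hi, mem_Exc.2 ⟨_, hi, rfl, rfl⟩, by simp [excInterval]; omega⟩
  have e2 : (Exc π).image (·.snd) = A.image (·.snd) := by
    ext v
    simp only [Finset.mem_image]
    constructor
    · rintro ⟨a, ha, rfl⟩
      obtain ⟨i, hi, h1, h2⟩ := mem_Exc.1 ha
      have := (hIJ i).2.2 ((hIJ i).1.1 hi)
      simp only [J, Finset.mem_filter, Finset.mem_univ, true_and] at this
      obtain ⟨b, hb, hb'⟩ := this
      exact ⟨b, hb, by omega⟩
    · rintro ⟨a, ha, rfl⟩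
      have hj : (⟨a.snd, (hr a ha).2.2⟩ : Fin n) ∈ J := by
        simp only [J, Finset.mem_filter, Finset.mem_univ, true_and]; exact ⟨a, ha, rfl⟩
      rw [← π.apply_symm_apply ⟨a.snd, (hr a ha).2.2⟩] at hj
      have hi := (hIJ _).1.2 ((hIJ _).2.1 hj)
      exact ⟨excInterval π _ hi, mem_Exc.2 ⟨_, hi, rfl, rfl⟩, by simp [excInterval]⟩
  have hE := Exc_mem_antichains hπ
  exact ⟨π, hπ, (antichain_subset_of_image_eq hE hA e1 e2).antisymm
    (antichain_subset_of_image_eq hA hE e1.symm e2.symm)⟩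

theorem Exc_bijOn (n : ℕ) : Set.BijOn (Exc (n := n)) (perms321 n) (antichains (n - 1)) :=
  ⟨fun _ => Exc_mem_antichains, Exc_injOn n, Exc_surjOn n⟩

end Excedances

/-! ### At least as many 321-avoiding permutations as Dyck paths -/

section DyckToPerm

variable {n : ℕ} (w : List DyckStep)

/-- The up steps in the odd positions `3, 5, …` of a path, as positions of a permutation. -/
def upPositions (n : ℕ) : Finset (Fin n) :=
  Finset.univ.filter fun i => w[2 * (i : ℕ) + 2]? = some DyckStep.U

/-- The down steps in the even positions `2, 4, …, 2n - 2` of a path, as values of a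
permutation. -/
def downValues (n : ℕ) : Finset (Fin n) :=
  Finset.univ.filter fun j => 1 ≤ (j : ℕ) ∧ w[2 * (j : ℕ) - 1]? = some DyckStep.D

variable {w}

lemma dyckPath_first (hw : w ∈ dyckPaths n) (hn : 0 < n) : w[0]? = some DyckStep.U := by
  obtain ⟨hl, h0, hpos⟩ := mem_dyckPaths.1 hw
  rcases getElem?_eq_U_or_D (w := w) (k := 0) (by omega) with h | h
  · exact h
  · have := height_succ_of_D h
    have := hpos 1 (by omega)
    have := height_zero w
    simp_all

lemma dyckPath_last (hw : w ∈ dyckPaths n) (hn : 0 < n) : w[2 * n - 1]? = some DyckStep.D := by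
  obtain ⟨hl, h0, hpos⟩ := mem_dyckPaths.1 hw
  rcases getElem?_eq_U_or_D (w := w) (k := 2 * n - 1) (by omega) with h | h
  · have := height_succ_of_U h
    have := hpos (2 * n - 1) (by omega)
    rw [Nat.sub_add_cancel (by omega)] at *
    omega
  · exact h

/-- The height of a Dyck path after `2t + 1` steps, in terms of the two sets. Nonnegativity of these
heights is the domination condition of `exists_perm321`. -/
lemma height_odd (hw : w ∈ dyckPaths n) (t : Fin n) :
    height w (2 * t + 1) = 1 + 2 * (((upPositions w n).filter (· < t)).card : ℤ) -
      2 * ((downValues w n).filter (· ≤ t)).card := by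
  obtain ⟨hl, h0, hpos⟩ := mem_dyckPaths.1 hw
  obtain ⟨t, ht⟩ := t
  induction t with
  | zero =>
    have h1 := height_succ_of_U (dyckPath_first hw ht)
    have e1 : (upPositions w n).filter (· < ⟨0, ht⟩) = ∅ := by
      ext i; simp [Fin.lt_def]
    have e2 : (downValues w n).filter (· ≤ ⟨0, ht⟩) = ∅ := by
      ext i; simp [Fin.le_def, downValues]; omega
    rw [e1, e2]
    simpa [height_zero] using h1
  | succ t ih =>
    have ih := ih (by omega)
    have e1 : (upPositions w n).filter (· < ⟨t + 1, ht⟩) =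
        if w[2 * t + 2]? = some DyckStep.U then
          insert ⟨t, by omega⟩ ((upPositions w n).filter (· < ⟨t, by omega⟩))
        else (upPositions w n).filter (· < ⟨t, by omega⟩) := by
      ext ⟨i, hi⟩
      split_ifs with h
      · simp only [upPositions, Finset.mem_filter, Finset.mem_univ, true_and, Finset.mem_insert,
          Fin.lt_def, Fin.mk.injEq]
        constructor
        · rintro ⟨h1, h2⟩
          by_cases hit : i = t
          · exact Or.inl hit
          · exact Or.inr ⟨h1, by omega⟩
        · rintro (rfl | ⟨h1, h2⟩)
          · exact ⟨h, by omega⟩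
          · exact ⟨h1, by omega⟩
      · simp only [upPositions, Finset.mem_filter, Finset.mem_univ, true_and, Fin.lt_def]
        constructor
        · rintro ⟨h1, h2⟩
          have : i ≠ t := by rintro rfl; exact h h1
          exact ⟨h1, by omega⟩
        · rintro ⟨h1, h2⟩
          exact ⟨h1, by omega⟩
    have e2 : (downValues w n).filter (· ≤ ⟨t + 1, ht⟩) =
        if w[2 * t + 1]? = some DyckStep.D then
          insert ⟨t + 1, by omega⟩ ((downValues w n).filter (· ≤ ⟨t, by omega⟩))
        else (downValues w n).filter (· ≤ ⟨t, by omega⟩) := by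
      have e : 2 * (t + 1) - 1 = 2 * t + 1 := by omega
      ext ⟨i, hi⟩
      split_ifs with h
      · simp only [downValues, Finset.mem_filter, Finset.mem_univ, true_and, Finset.mem_insert,
          Fin.le_def, Fin.mk.injEq]
        constructor
        · rintro ⟨h1, h2⟩
          by_cases hit : i = t + 1
          · exact Or.inl hit
          · exact Or.inr ⟨h1, by omega⟩
        · rintro (rfl | ⟨h1, h2⟩)
          · exact ⟨⟨by omega, by rwa [e]⟩, by omega⟩
          · exact ⟨h1, by omega⟩
      · simp only [downValues, Finset.mem_filter, Finset.mem_univ, true_and, Fin.le_def]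
        constructor
        · rintro ⟨h1, h2⟩
          have : i ≠ t + 1 := by rintro rfl; rw [e] at h1; exact h h1.2
          exact ⟨h1, by omega⟩
        · rintro ⟨h1, h2⟩
          exact ⟨h1, by omega⟩
    have n1 : (⟨t, by omega⟩ : Fin n) ∉ (upPositions w n).filter (· < ⟨t, by omega⟩) := by simp
    have n2 : (⟨t + 1, by omega⟩ : Fin n) ∉ (downValues w n).filter (· ≤ ⟨t, by omega⟩) := by
      simp [Fin.le_def]
    rw [e1, e2]
    simp only at ih ⊢
    have e3 : 2 * (t + 1) + 1 = 2 * t + 1 + 1 + 1 := by ring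
    rw [e3]
    rcases getElem?_eq_U_or_D (w := w) (k := 2 * t + 1) (by omega) with h1 | h1 <;>
    rcases getElem?_eq_U_or_D (w := w) (k := 2 * t + 1 + 1) (by omega) with h2 | h2
    · rw [height_succ_of_U h2, height_succ_of_U h1, ih, if_pos h2, if_neg (by simp [h1]),
        Finset.card_insert_of_notMem n1]
      push_cast; ring
    · rw [height_succ_of_D h2, height_succ_of_U h1, ih, if_neg (by simp [h2]),
        if_neg (by simp [h1])]
      ring
    · rw [height_succ_of_U h2, height_succ_of_D h1, ih, if_pos h2, if_pos h1,
        Finset.card_insert_of_notMem n1, Finset.card_insert_of_notMem n2]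
      push_cast; ring
    · rw [height_succ_of_D h2, height_succ_of_D h1, ih, if_neg (by simp [h2]), if_pos h1,
        Finset.card_insert_of_notMem n2]
      push_cast; ring

/-- Excedance positions and excedance values can be prescribed by a Dyck path. -/
lemma exists_perm321_of_dyckPath (hw : w ∈ dyckPaths n) :
    ∃ π ∈ perms321 n, ∀ i, (i < π i ↔ i ∈ upPositions w n) ∧
      (π i ∈ downValues w n ↔ i ∈ upPositions w n) := by
  obtain ⟨hl, h0, hpos⟩ := mem_dyckPaths.1 hw
  refine exists_perm321 _ _ ?_ fun t => ?_
  · rcases Nat.eq_zero_or_pos n with rfl | hn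
    · rfl
    · have h1 := height_odd hw ⟨n - 1, by omega⟩
      have h2 := height_succ_of_D (dyckPath_last hw hn)
      have e1 : 2 * (n - 1) + 1 = 2 * n - 1 := by omega
      rw [Nat.sub_add_cancel (by omega)] at h2
      have f1 : (upPositions w n).filter (· < ⟨n - 1, by omega⟩) = upPositions w n := by
        refine Finset.filter_true_of_mem fun i hi => ?_
        simp only [upPositions, Finset.mem_filter] at hi
        rw [Fin.lt_def]
        by_contra hc
        simp only at hc
        rw [List.getElem?_eq_none (by omega)] at hi
        simp at hi
      have f2 : (downValues w n).filter (· ≤ ⟨n - 1, by omega⟩) = downValues w n := by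
        refine Finset.filter_true_of_mem fun i hi => ?_
        rw [Fin.le_def]
        simp only
        omega
      rw [f1, f2] at h1
      simp only [e1] at h1
      omega
  · have h1 := height_odd hw t
    have h2 := hpos (2 * t + 1) (by omega)
    omega

lemma dyckPath_ext {w' : List DyckStep} (hw : w ∈ dyckPaths n) (hw' : w' ∈ dyckPaths n)
    (h1 : upPositions w n = upPositions w' n) (h2 : downValues w n = downValues w' n) : w = w' := by
  have hl := (mem_dyckPaths.1 hw).1
  have hl' := (mem_dyckPaths.1 hw').1
  refine List.ext_getElem? fun k => ?_
  by_cases hk : k < 2 * n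
  · rcases Nat.even_or_odd' k with ⟨m, rfl | rfl⟩
    · rcases Nat.eq_zero_or_pos m with rfl | hm
      · rw [dyckPath_first hw (by omega), dyckPath_first hw' (by omega)]
      · have := Finset.ext_iff.1 h1 ⟨m - 1, by omega⟩
        have e : 2 * (m - 1) + 2 = 2 * m := by omega
        simp only [upPositions, Finset.mem_filter, Finset.mem_univ, true_and, e] at this
        rcases getElem?_eq_U_or_D (w := w) (k := 2 * m) (by omega) with h | h <;>
        rcases getElem?_eq_U_or_D (w := w') (k := 2 * m) (by omega) with h' | h' <;>
        simp_all
    · by_cases hm : m + 1 = n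
      · have e : 2 * m + 1 = 2 * n - 1 := by omega
        rw [e, dyckPath_last hw (by omega), dyckPath_last hw' (by omega)]
      · have := Finset.ext_iff.1 h2 ⟨m + 1, by omega⟩
        have e : 2 * (m + 1) - 1 = 2 * m + 1 := by omega
        simp only [downValues, Finset.mem_filter, Finset.mem_univ, true_and, e,
          Nat.le_add_left] at this
        rcases getElem?_eq_U_or_D (w := w) (k := 2 * m + 1) (by omega) with h | h <;>
        rcases getElem?_eq_U_or_D (w := w') (k := 2 * m + 1) (by omega) with h' | h' <;>
        simp_all
  · rw [List.getElem?_eq_none (by omega), List.getElem?_eq_none (by omega)]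

lemma ncard_dyckPaths_le (n : ℕ) : (dyckPaths n).ncard ≤ (perms321 n).ncard := by
  classical
  choose! F hF using fun (w : List DyckStep) (hw : w ∈ dyckPaths n) =>
    exists_perm321_of_dyckPath hw
  refine Set.ncard_le_ncard_of_injOn F (fun w hw => (hF w hw).1) ?_ (Set.toFinite _)
  intro w hw w' hw' h
  have a := (hF w hw).2
  have b := (hF w' hw').2
  rw [h] at a
  have hI : upPositions w n = upPositions w' n := by
    ext i; rw [← (a i).1, ← (b i).1]
  refine dyckPath_ext hw hw' hI ?_
  ext j
  have a' := (a ((F w').symm j)).2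
  have b' := (b ((F w').symm j)).2
  rw [Equiv.apply_symm_apply] at a' b'
  rw [a', b', hI]

end DyckToPerm

/-! ### The top rows of the tableaux -/

/-- Row insertion into an increasing row either appends the letter or replaces the smallest larger
entry by it. -/
lemma rowInsert_spec {r : List ℕ} {x : ℕ} (hr : r.Pairwise (· < ·)) (hx : x ∉ r) :
    (rowInsert r x).1.Pairwise (· < ·) ∧
    ((rowInsert r x).2 = none → (∀ z ∈ r, z < x) ∧ ∀ z, z ∈ (rowInsert r x).1 ↔ z ∈ r ∨ z = x) ∧
    (∀ y, (rowInsert r x).2 = some y → y ∈ r ∧ x < y ∧ (∀ z ∈ r, z < y → z < x) ∧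
      ∀ z, z ∈ (rowInsert r x).1 ↔ (z ∈ r ∧ z ≠ y) ∨ z = x) := by
  induction r with
  | nil => simp [rowInsert]
  | cons a r ih =>
    rw [List.pairwise_cons] at hr
    rw [List.mem_cons, not_or] at hx
    obtain ⟨ih1, ih2, ih3⟩ := ih hr.2 hx.2
    by_cases hxa : x < a
    · simp only [rowInsert, if_pos hxa, List.pairwise_cons, reduceCtorEq, false_implies, true_and,
        Option.some.injEq]
      refine ⟨⟨fun z hz => hxa.trans (hr.1 z hz), hr.2⟩, ?_⟩
      rintro y rfl
      refine ⟨List.mem_cons_self, hxa, fun z hz hza => ?_, fun z => ?_⟩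
      · rcases List.mem_cons.1 hz with rfl | hz
        · omega
        · have := hr.1 z hz; omega
      · simp only [List.mem_cons]
        constructor
        · rintro (rfl | hz)
          · exact Or.inr rfl
          · have := hr.1 z hz
            exact Or.inl ⟨Or.inr hz, by omega⟩
        · rintro (⟨rfl | hz, hne⟩ | rfl)
          · exact absurd rfl hne
          · exact Or.inr hz
          · exact Or.inl rfl
    · have hax : a < x := by omega
      simp only [rowInsert, if_neg hxa, List.pairwise_cons]
      refine ⟨⟨fun z hz => ?_, ih1⟩, fun h => ?_, fun y hy => ?_⟩
      · rcases h : (rowInsert r x).2 with _ | y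
        · rcases ((ih2 h).2 z).1 hz with h | rfl
          · exact hr.1 z h
          · exact hax
        · rcases ((ih3 y h).2.2.2 z).1 hz with h | rfl
          · exact hr.1 z h.1
          · exact hax
      · obtain ⟨h1, h2⟩ := ih2 h
        refine ⟨fun z hz => ?_, fun z => ?_⟩
        · rcases List.mem_cons.1 hz with rfl | hz
          · exact hax
          · exact h1 z hz
        · simp only [List.mem_cons, h2, or_assoc]
      · obtain ⟨h1, h2, h3, h4⟩ := ih3 y hy
        refine ⟨List.mem_cons_of_mem _ h1, h2, fun z hz hzy => ?_, fun z => ?_⟩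
        · rcases List.mem_cons.1 hz with rfl | hz
          · exact hax
          · exact h3 z hz hzy
        · have := hr.1 y h1
          simp only [List.mem_cons, h4]
          constructor
          · rintro (rfl | h | h)
            · exact Or.inl ⟨Or.inl rfl, by omega⟩
            · exact Or.inl ⟨Or.inr h.1, h.2⟩
            · exact Or.inr h
          · rintro (⟨h | h, h'⟩ | h)
            · exact Or.inl h
            · exact Or.inr (Or.inl ⟨h, h'⟩)
            · exact Or.inr (Or.inr h)

/-- The top row of the insertion tableau of the word `p 1, …, p k`. -/
def row (p : ℕ → ℕ) : ℕ → List ℕ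
  | 0 => []
  | k + 1 => (rowInsert (row p k) (p (k + 1))).1

/-- The entry that is bumped from the top row when the `k`-th letter of `p 1, p 2, …` is
inserted. -/
def bump (p : ℕ → ℕ) (k : ℕ) : Option ℕ := (rowInsert (row p (k - 1)) (p k)).2

/-- The top rows of both tableaux depend on the top row of the insertion tableau only: the recording
tableau grows in its top row exactly when nothing is bumped. -/
lemma topRow_foldl_rskStep (p : ℕ → ℕ) (m : ℕ) :
    let PQ := ((List.range' 1 m).map fun k => (k, p k)).foldl rskStep ([], [])
    topRow PQ.1 = row p m ∧ (PQ.1 = [] ↔ PQ.2 = []) ∧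
      topRow PQ.2 = (List.range' 1 m).filter fun k => (bump p k).isNone := by
  induction m with
  | zero => simp [topRow, row]
  | succ m ih =>
    obtain ⟨ih1, ih2, ih3⟩ := ih
    simp only [List.range'_concat, List.map_append, List.foldl_append, List.map_cons, List.map_nil,
      List.foldl_cons, List.foldl_nil, List.filter_append]
    have e : 1 + 1 * m = m + 1 := by ring
    rw [e]
    generalize (((List.range' 1 m).map fun k => (k, p k)).foldl rskStep ([], [])) = PQ at *
    obtain ⟨P, Q⟩ := PQ
    simp only at ih1 ih2 ih3
    rw [← ih3]
    have hb : bump p (m + 1) = (rowInsert (row p m) (p (m + 1))).2 := rfl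
    have hr : row p (m + 1) = (rowInsert (row p m) (p (m + 1))).1 := rfl
    rw [← ih1] at hb hr
    cases P with
    | nil =>
      obtain rfl := ih2.1 rfl
      simp only [topRow, List.headD_nil, rowInsert] at hb hr
      simp [rskStep, tabInsert, addToRow, topRow, hb, hr]
    | cons r T =>
      cases Q with
      | nil => simp at ih2
      | cons q S =>
        simp only [topRow, List.headD_cons] at hb hr
        rcases h : rowInsert r (p (m + 1)) with ⟨r', _ | y⟩
        · simp [rskStep, tabInsert, h, addToRow, topRow, hb, hr]
        · simp [rskStep, tabInsert, h, addToRow, topRow, hb, hr]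

/-- A permutation of `{1, …, n}` given by its values `p 1, …, p n`, whose excedances are
left-to-right maxima and whose other positions are right-to-left minima. -/
structure IsWord321 (n : ℕ) (p : ℕ → ℕ) : Prop where
  range : ∀ k, 1 ≤ k → k ≤ n → 1 ≤ p k ∧ p k ≤ n
  inj : ∀ j k, 1 ≤ j → j ≤ n → 1 ≤ k → k ≤ n → p j = p k → j = k
  surj : ∀ v, 1 ≤ v → v ≤ n → ∃ k, 1 ≤ k ∧ k ≤ n ∧ p k = v
  exc : ∀ j k, 1 ≤ j → j < k → k ≤ n → k < p k → p j < p k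
  nonexc : ∀ j k, 1 ≤ j → j < k → k ≤ n → p j ≤ j → p j < p k

/-- `doomed n p k` consists of the entries of the top row after `k` insertions that are bumped
later. -/
def doomed (n : ℕ) (p : ℕ → ℕ) (k : ℕ) : Finset ℕ :=
  (row p k).toFinset.filter (· ∉ row p n)

lemma mem_doomed {n : ℕ} {p : ℕ → ℕ} {k z : ℕ} :
    z ∈ doomed n p k ↔ z ∈ row p k ∧ z ∉ row p n := by simp [doomed]

namespace IsWord321

variable {n : ℕ} {p : ℕ → ℕ}

lemma row_sorted (h : IsWord321 n p) {k : ℕ} (hk : k ≤ n) :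
    (row p k).Pairwise (· < ·) ∧ ∀ z ∈ row p k, ∃ m, 1 ≤ m ∧ m ≤ k ∧ p m = z := by
  induction k with
  | zero => simp [row]
  | succ k ih =>
    obtain ⟨ih1, ih2⟩ := ih (by omega)
    have hx : p (k + 1) ∉ row p k := fun hc => by
      obtain ⟨m, h1, h2, h3⟩ := ih2 _ hc
      have := h.inj m (k + 1) h1 (by omega) (by omega) hk h3
      omega
    obtain ⟨s1, s2, s3⟩ := rowInsert_spec ih1 hx
    refine ⟨s1, fun z hz => ?_⟩
    have : z ∈ row p k ∨ z = p (k + 1) := by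
      rcases hb : (rowInsert (row p k) (p (k + 1))).2 with _ | y
      · exact ((s2 hb).2 z).1 hz
      · rcases ((s3 y hb).2.2.2 z).1 hz with h | h
        · exact Or.inl h.1
        · exact Or.inr h
    rcases this with hz | rfl
    · obtain ⟨m, h1, h2, h3⟩ := ih2 z hz
      exact ⟨m, h1, by omega, h3⟩
    · exact ⟨k + 1, by omega, le_rfl, rfl⟩

lemma exists_of_mem_row (h : IsWord321 n p) {k z : ℕ} (hk : k ≤ n) (hz : z ∈ row p k) :
    ∃ m, 1 ≤ m ∧ m ≤ k ∧ p m = z := (h.row_sorted hk).2 z hz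

lemma not_mem_row (h : IsWord321 n p) {k : ℕ} (hk : k < n) : p (k + 1) ∉ row p k := fun hc => by
  obtain ⟨m, h1, h2, h3⟩ := h.exists_of_mem_row hk.le hc
  have := h.inj m (k + 1) h1 (by omega) (by omega) hk h3
  omega

lemma mem_row_succ (h : IsWord321 n p) {k : ℕ} (hk : k < n) (z : ℕ) :
    z ∈ row p (k + 1) ↔ (z ∈ row p k ∧ bump p (k + 1) ≠ some z) ∨ z = p (k + 1) := by
  obtain ⟨s1, s2, s3⟩ := rowInsert_spec (h.row_sorted hk.le).1 (h.not_mem_row hk)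
  rcases hb : bump p (k + 1) with _ | y
  · simpa [row] using (s2 hb).2 z
  · rw [ne_comm (a := some y)]
    simpa [row] using (s3 y hb).2.2.2 z

lemma bump_none (h : IsWord321 n p) {k : ℕ} (hk : k < n) (hb : bump p (k + 1) = none) :
    ∀ z ∈ row p k, z < p (k + 1) :=
  ((rowInsert_spec (h.row_sorted hk.le).1 (h.not_mem_row hk)).2.1 hb).1

lemma bump_some (h : IsWord321 n p) {k y : ℕ} (hk : k < n) (hb : bump p (k + 1) = some y) :
    y ∈ row p k ∧ p (k + 1) < y ∧ ∀ z ∈ row p k, z < y → z < p (k + 1) := by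
  have := (rowInsert_spec (h.row_sorted hk.le).1 (h.not_mem_row hk)).2.2 y hb
  exact ⟨this.1, this.2.1, this.2.2.1⟩

lemma bump_exc (h : IsWord321 n p) {k : ℕ} (hk : k < n) (he : k + 1 < p (k + 1)) :
    bump p (k + 1) = none := by
  rcases hb : bump p (k + 1) with _ | y
  · rfl
  · obtain ⟨h1, h2, -⟩ := h.bump_some hk hb
    obtain ⟨m, m1, m2, rfl⟩ := h.exists_of_mem_row hk.le h1
    have := h.exc m (k + 1) m1 (by omega) hk he
    omega

/-- A letter in a position that is not an excedance is never bumped. -/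
lemma nonexc_mem_row (h : IsWord321 n p) {m k : ℕ} (hm : 1 ≤ m) (hmk : m ≤ k) (hk : k ≤ n)
    (he : p m ≤ m) :
    p m ∈ row p k := by
  induction k, hmk using Nat.le_induction with
  | base =>
    obtain ⟨m, rfl⟩ := Nat.exists_eq_add_of_le' hm
    exact (h.mem_row_succ hk _).2 (Or.inr rfl)
  | succ k hmk ih =>
    refine (h.mem_row_succ hk _).2 (Or.inl ⟨ih (by omega), fun hb => ?_⟩)
    have := (h.bump_some hk hb).2.1
    have := h.nonexc m (k + 1) hm (by omega) hk he
    omega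

/-- An entry that has left the top row does not come back. -/
lemma mem_row_of_mem_row (h : IsWord321 n p) {m j k : ℕ} (hm : 1 ≤ m) (hmj : m ≤ j) (hjk : j ≤ k)
    (hk : k ≤ n) (hz : p m ∈ row p k) : p m ∈ row p j := by
  induction k, hjk using Nat.le_induction with
  | base => exact hz
  | succ k hjk ih =>
    refine ih (by omega) ?_
    rcases (h.mem_row_succ hk _).1 hz with h1 | h1
    · exact h1.1
    · have := h.inj _ _ hm (by omega) (by omega) hk h1
      omega

lemma exists_bump (h : IsWord321 n p) {j k z : ℕ} (hjk : j ≤ k) (hk : k ≤ n) (hz : z ∈ row p j)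
    (hz' : z ∉ row p k) :
    ∃ t, j ≤ t ∧ t < k ∧ bump p (t + 1) = some z := by
  induction k, hjk using Nat.le_induction with
  | base => exact absurd hz hz'
  | succ k hjk ih =>
    by_cases hzk : z ∈ row p k
    · rw [h.mem_row_succ hk] at hz'
      push Not at hz'
      exact ⟨k, hjk, by omega, hz'.1 hzk⟩
    · obtain ⟨t, h1, h2, h3⟩ := ih (by omega) hzk
      exact ⟨t, h1, by omega, h3⟩

lemma not_mem_row_of_bump (h : IsWord321 n p) {k y j : ℕ} (hk : k < n) (hb : bump p (k + 1) = some y)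
    (hkj : k < j) (hj : j ≤ n) : y ∉ row p j := fun hc => by
  obtain ⟨h1, h2, -⟩ := h.bump_some hk hb
  obtain ⟨m, m1, m2, rfl⟩ := h.exists_of_mem_row hk.le h1
  have := h.mem_row_of_mem_row m1 (show m ≤ k + 1 by omega) hkj hj hc
  rcases (h.mem_row_succ hk _).1 this with h3 | h3
  · exact h3.2 hb
  · omega

/-- If the insertion of a letter that is not an excedance bumps nothing from the top row, then the
row will not lose any of its entries. -/
lemma doomed_eq_empty_of_nonexc (h : IsWord321 n p) {k : ℕ} (hk : k < n) (he : p (k + 1) ≤ k + 1)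
    (hb : bump p (k + 1) = none) : doomed n p k = ∅ := by
  rw [Finset.eq_empty_iff_forall_notMem]
  intro z hz
  rw [mem_doomed] at hz
  obtain ⟨t, h1, h2, h3⟩ := h.exists_bump hk.le le_rfl hz.1 hz.2
  have h4 := h.bump_none hk hb z hz.1
  rcases h1.eq_or_lt with rfl | h1
  · rw [hb] at h3; cases h3
  · have := h.nonexc (k + 1) (t + 1) (by omega) (by omega) (by omega) he
    have := (h.bump_some h2 h3).2.1
    omega

lemma card_doomed_nonexc_none (h : IsWord321 n p) {k : ℕ} (hk : k < n) (he : p (k + 1) ≤ k + 1)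
    (hb : bump p (k + 1) = none) :
    (doomed n p k).card = 0 ∧ (doomed n p (k + 1)).card = 0 := by
  have h0 := h.doomed_eq_empty_of_nonexc hk he hb
  refine ⟨by rw [h0]; rfl, ?_⟩
  rw [Finset.card_eq_zero, Finset.eq_empty_iff_forall_notMem]
  intro z hz
  rw [mem_doomed, h.mem_row_succ hk] at hz
  obtain ⟨h1 | rfl, h2⟩ := hz
  · have : z ∈ doomed n p k := mem_doomed.2 ⟨h1.1, h2⟩
    rw [h0] at this
    simp at this
  · exact h2 (h.nonexc_mem_row (by omega) hk le_rfl he)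

lemma card_doomed_nonexc_some (h : IsWord321 n p) {k y : ℕ} (hk : k < n) (he : p (k + 1) ≤ k + 1)
    (hb : bump p (k + 1) = some y) :
    (doomed n p k).card = (doomed n p (k + 1)).card + 1 := by
  have hy : y ∈ doomed n p k :=
    mem_doomed.2 ⟨(h.bump_some hk hb).1, h.not_mem_row_of_bump hk hb hk le_rfl⟩
  have : doomed n p (k + 1) = (doomed n p k).erase y := by
    ext z
    rw [Finset.mem_erase, mem_doomed, mem_doomed, h.mem_row_succ hk, hb]
    simp only [ne_eq, Option.some.injEq]
    constructor
    · rintro ⟨h1 | rfl, h2⟩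
      · exact ⟨fun h => h1.2 h.symm, h1.1, h2⟩
      · exact absurd (h.nonexc_mem_row (by omega) hk le_rfl he) h2
    · rintro ⟨h1, h2, h3⟩
      exact ⟨Or.inl ⟨h2, fun h => h1 h.symm⟩, h3⟩
  rw [this, Finset.card_erase_add_one hy]

lemma card_doomed_exc (h : IsWord321 n p) {k : ℕ} (hk : k < n) (he : k + 1 < p (k + 1)) :
    (doomed n p (k + 1)).card =
      (doomed n p k).card + if p (k + 1) ∈ row p n then 0 else 1 := by
  have hb := h.bump_exc hk he
  split_ifs with hr
  · rw [add_zero]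
    congr 1
    ext z
    rw [mem_doomed, mem_doomed, h.mem_row_succ hk, hb]
    constructor
    · rintro ⟨h1 | rfl, h2⟩
      · exact ⟨h1.1, h2⟩
      · exact absurd hr h2
    · rintro ⟨h1, h2⟩
      exact ⟨Or.inl ⟨h1, by simp⟩, h2⟩
  · have : doomed n p (k + 1) = insert (p (k + 1)) (doomed n p k) := by
      ext z
      rw [Finset.mem_insert, mem_doomed, mem_doomed, h.mem_row_succ hk, hb]
      constructor
      · rintro ⟨h1 | rfl, h2⟩
        · exact Or.inr ⟨h1.1, h2⟩
        · exact Or.inl rfl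
      · rintro (rfl | ⟨h1, h2⟩)
        · exact ⟨Or.inr rfl, hr⟩
        · exact ⟨Or.inl ⟨h1, by simp⟩, h2⟩
    rw [this, Finset.card_insert_of_notMem]
    exact fun hc => h.not_mem_row hk (mem_doomed.1 hc).1

/-- The number of smaller letters that come after an excedance. -/
lemma card_later_lt (h : IsWord321 n p) {i : ℕ} (hi : 1 ≤ i) (hin : i ≤ n) (he : i < p i) :
    ((Finset.Ioc i n).filter fun t => p t < p i).card = p i - i := by
  have h1 : (((Finset.Icc 1 n).filter fun t => p t < p i).image p) = Finset.Ico 1 (p i) := by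
    ext v
    simp only [Finset.mem_image, Finset.mem_filter, Finset.mem_Icc, Finset.mem_Ico]
    constructor
    · rintro ⟨t, ⟨⟨t1, t2⟩, t3⟩, rfl⟩
      exact ⟨(h.range t t1 t2).1, t3⟩
    · rintro ⟨v1, v2⟩
      obtain ⟨t, t1, t2, rfl⟩ := h.surj v v1 (by have := h.range i hi hin; omega)
      exact ⟨t, ⟨⟨t1, t2⟩, v2⟩, rfl⟩
  have h2 : ((Finset.Icc 1 n).filter fun t => p t < p i).card = p i - 1 := by
    rw [← Nat.card_Ico, ← h1, Finset.card_image_of_injOn]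
    intro a ha b hb hab
    simp only [Finset.coe_filter, Finset.mem_Icc, Set.mem_ofPred_eq] at ha hb
    exact h.inj a b ha.1.1 ha.1.2 hb.1.1 hb.1.2 hab
  have h3 : (Finset.Icc 1 n).filter (fun t => p t < p i) =
      Finset.Ico 1 i ∪ (Finset.Ioc i n).filter fun t => p t < p i := by
    ext t
    simp only [Finset.mem_filter, Finset.mem_Icc, Finset.mem_union, Finset.mem_Ico,
      Finset.mem_Ioc]
    constructor
    · rintro ⟨⟨t1, t2⟩, t3⟩
      rcases lt_trichotomy t i with hlt | rfl | hlt
      · exact Or.inl ⟨t1, hlt⟩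
      · omega
      · exact Or.inr ⟨⟨hlt, t2⟩, t3⟩
    · rintro (⟨t1, t2⟩ | ⟨⟨t1, t2⟩, t3⟩)
      · exact ⟨⟨t1, by omega⟩, h.exc t i t1 t2 hin he⟩
      · exact ⟨⟨by omega, t2⟩, t3⟩
  rw [h3, Finset.card_union_of_disjoint, Nat.card_Ico] at h2
  · omega
  · rw [Finset.disjoint_left]
    intro t t1 t2
    simp only [Finset.mem_Ico, Finset.mem_filter, Finset.mem_Ioc] at t1 t2
    omega

/-- An excedance value is bumped exactly if there are more smaller letters after it than are needed
to bump the doomed entries before it. -/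
lemma exc_not_mem_row_iff (h : IsWord321 n p) {k : ℕ} (hk : k < n) (he : k + 1 < p (k + 1)) :
    p (k + 1) ∉ row p n ↔ (doomed n p k).card < p (k + 1) - (k + 1) := by
  rw [← h.card_later_lt (i := k + 1) (by omega) hk he]
  have hnone := h.bump_exc hk he
  have hmem : p (k + 1) ∈ row p (k + 1) := (h.mem_row_succ hk _).2 (Or.inr rfl)
  constructor
  · intro hj
    -- the doomed entries and `p (k + 1)` itself are bumped by different letters
    have hcard : (insert (p (k + 1)) (doomed n p k)).card ≤
        ((Finset.Ioc (k + 1) n).filter fun t => p t < p (k + 1)).card := by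
      obtain ⟨t₀, h1, h2, h3⟩ := h.exists_bump hk le_rfl hmem hj
      obtain ⟨b1, b2, b3⟩ := h.bump_some h2 h3
      refine Finset.card_le_card_of_forall_subsingleton (fun y t => bump p t = some y) ?_ ?_
      · intro y hy
        rcases Finset.mem_insert.1 hy with rfl | hy
        · refine ⟨t₀ + 1, ?_, h3⟩
          simp only [Finset.mem_filter, Finset.mem_Ioc]
          omega
        · rw [mem_doomed] at hy
          have hyj := h.bump_none hk hnone y hy.1
          obtain ⟨t, a1, a2, a3⟩ := h.exists_bump hk.le le_rfl hy.1 hy.2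
          have htk : t ≠ k := by rintro rfl; rw [hnone] at a3; cases a3
          have := (h.bump_some a2 a3).2.1
          refine ⟨t + 1, ?_, a3⟩
          simp only [Finset.mem_filter, Finset.mem_Ioc]
          omega
      · intro t ht y hy z hz
        have := hy.2.symm.trans hz.2
        simpa using this
    rw [Finset.card_insert_of_notMem fun hc => h.not_mem_row hk (mem_doomed.1 hc).1] at hcard
    omega
  · intro hlt hj
    -- `p (k + 1)` is always in the row, so that each smaller letter bumps a doomed entry
    refine absurd hlt (not_lt.2 ?_)
    refine Finset.card_le_card_of_forall_subsingleton (fun t y => bump p t = some y) ?_ ?_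
    · intro t ht
      simp only [Finset.mem_filter, Finset.mem_Ioc] at ht
      obtain ⟨t, rfl⟩ := Nat.exists_eq_add_of_le' (show 1 ≤ t by omega)
      have hjt : p (k + 1) ∈ row p t :=
        h.mem_row_of_mem_row (by omega) (by omega) (by omega) le_rfl hj
      rcases hb : bump p (t + 1) with _ | y
      · have := h.bump_none (by omega) hb _ hjt
        omega
      · obtain ⟨b1, b2, b3⟩ := h.bump_some (by omega) hb
        have hy : y ∉ row p n := h.not_mem_row_of_bump (by omega) hb (by omega) le_rfl
        have hyj : y < p (k + 1) := by
          rcases lt_trichotomy y (p (k + 1)) with hlt | heq | hlt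
          · exact hlt
          · exact absurd (heq ▸ hj) hy
          · have := b3 _ hjt hlt
            omega
        obtain ⟨m, m1, m2, rfl⟩ := h.exists_of_mem_row (by omega) b1
        have hme : m < p m := by
          by_contra hc
          exact hy (h.nonexc_mem_row m1 (by omega) le_rfl (by omega))
        have hmk : m < k + 1 := by
          by_contra hc
          rcases (not_lt.1 hc).eq_or_lt with heq | hlt
          · rw [← heq] at hyj; omega
          · have := h.exc (k + 1) m (by omega) hlt (by omega) hme
            omega
        exact ⟨p m, mem_doomed.2
          ⟨h.mem_row_of_mem_row m1 (by omega) (by omega) (by omega) b1, hy⟩, rfl⟩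
    · rintro y - t ⟨ht, hty⟩ t' ⟨ht', hty'⟩
      simp only [Finset.mem_filter, Finset.mem_Ioc] at ht ht'
      have key : ∀ {a b : ℕ}, a < b → k + 1 < a → b ≤ n → bump p a = some y →
          bump p b ≠ some y := fun {a b} hab hka hb ha hc => by
        obtain ⟨a, rfl⟩ := Nat.exists_eq_add_of_le' (show 1 ≤ a by omega)
        obtain ⟨b, rfl⟩ := Nat.exists_eq_add_of_le' (show 1 ≤ b by omega)
        exact h.not_mem_row_of_bump (by omega) ha (show a < b by omega) (by omega)
          (h.bump_some (by omega) hc).1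
      rcases lt_trichotomy t t' with hlt | heq | hlt
      · exact absurd hty' (key hlt ht.1.1 ht'.1.2 hty)
      · exact heq
      · exact absurd hty (key hlt ht'.1.1 ht.1.2 hty')

end IsWord321

section Letters

variable {n : ℕ} (π : Equiv.Perm (Fin n))

/-- The values of a permutation of `{1, …, n}`, extended by `0` outside this set. -/
def letter (k : ℕ) : ℕ := if hk : k - 1 < n ∧ 1 ≤ k then (π ⟨k - 1, hk.1⟩ : ℕ) + 1 else 0

variable {π}

lemma letter_succ (i : Fin n) : letter π (i + 1) = π i + 1 := by
  simp [letter]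

lemma exists_fin_of_mem {k : ℕ} (h1 : 1 ≤ k) (h2 : k ≤ n) : ∃ i : Fin n, k = i + 1 :=
  ⟨⟨k - 1, by omega⟩, by simp; omega⟩

lemma isWord321_letter (hπ : π ∈ perms321 n) : IsWord321 n (letter π) where
  range k h1 h2 := by
    obtain ⟨i, rfl⟩ := exists_fin_of_mem h1 h2
    rw [letter_succ]; omega
  inj j k h1 h2 h3 h4 h5 := by
    obtain ⟨i, rfl⟩ := exists_fin_of_mem h1 h2
    obtain ⟨j, rfl⟩ := exists_fin_of_mem h3 h4
    rw [letter_succ, letter_succ, Nat.add_right_cancel_iff, Fin.val_inj, π.injective.eq_iff] at h5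
    rw [h5]
  surj v h1 h2 := by
    obtain ⟨i, rfl⟩ := exists_fin_of_mem h1 h2
    exact ⟨π.symm i + 1, by omega, by omega, by rw [letter_succ]; simp⟩
  exc j k h1 h2 h3 h4 := by
    obtain ⟨i, rfl⟩ := exists_fin_of_mem h1 (show j ≤ n by omega)
    obtain ⟨k, rfl⟩ := exists_fin_of_mem (show 1 ≤ k by omega) h3
    rw [letter_succ] at h4 ⊢
    rw [letter_succ]
    have := Fin.lt_def.1
      (lt_of_lt_excedance hπ (i := k) (j := i) (Fin.lt_def.2 (by omega)) (Fin.lt_def.2 (by omega)))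
    omega
  nonexc j k h1 h2 h3 h4 := by
    obtain ⟨i, rfl⟩ := exists_fin_of_mem h1 (show j ≤ n by omega)
    obtain ⟨k, rfl⟩ := exists_fin_of_mem (show 1 ≤ k by omega) h3
    rw [letter_succ] at h4 ⊢
    rw [letter_succ]
    have := Fin.lt_def.1 (lt_of_not_excedance_lt hπ (i := i) (k := k)
      (Fin.le_def.2 (by omega)) (Fin.lt_def.2 (by omega)))
    omega

lemma topRow_RSK (π : Equiv.Perm (Fin n)) :
    topRow (RSK π).1 = row (letter π) n ∧
      topRow (RSK π).2 = (List.range' 1 n).filter fun k => (bump (letter π) k).isNone := by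
  have e : (List.ofFn fun i : Fin n => ((i : ℕ) + 1, (π i : ℕ) + 1)) =
      (List.range' 1 n).map fun k => (k, letter π k) := by
    refine List.ext_getElem (by simp) fun i h1 h2 => ?_
    have hi : i < n := by simpa using h1
    have := letter_succ (π := π) ⟨i, hi⟩
    simp only at this
    simp [add_comm 1 i, this]
  have := topRow_foldl_rskStep (letter π) n
  rw [RSK, e]
  exact ⟨this.1, this.2.2⟩

lemma RSKD_length (π : Equiv.Perm (Fin n)) : (RSKD π).length = 2 * n := by
  simp [RSKD]; ring

lemma RSKD_getElem?_value {v : ℕ} (h1 : 1 ≤ v) (h2 : v ≤ n) :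
    (RSKD π)[v - 1]? = some (if v ∈ row (letter π) n then DyckStep.U else DyckStep.D) := by
  rw [RSKD, List.getElem?_append_left (by simp; omega), (topRow_RSK π).1]
  rw [List.getElem?_map, List.getElem?_range' (by omega)]
  simp [show 1 + (v - 1) = v by omega]

lemma RSKD_getElem?_time {k : ℕ} (h1 : 1 ≤ k) (h2 : k ≤ n) :
    (RSKD π)[2 * n + 1 - k - 1]? =
      some (if bump (letter π) k = none then DyckStep.D else DyckStep.U) := by
  rw [RSKD, List.getElem?_append_right (by simp; omega), (topRow_RSK π).2,
    List.getElem?_reverse (by simp; omega), List.getElem?_map,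
    List.getElem?_range' (by simp; omega)]
  have : 1 + 1 * (n - 1 - (2 * n + 1 - k - 1 - n)) = k := by omega
  simp only [List.length_map, List.length_range', this]
  simp [h1, show k < 1 + n by omega]

end Letters

/-! ### The nearest unmatched vertex -/

/-- The set of endpoints of the arcs of `M`. -/
def cov (M : Finset (ℕ × ℕ)) : Finset ℕ := M.image Prod.fst ∪ M.image Prod.snd

lemma mem_cov {M : Finset (ℕ × ℕ)} {v : ℕ} : v ∈ cov M ↔ ∃ a ∈ M, a.1 = v ∨ a.2 = v := by
  simp only [cov, Finset.mem_union, Finset.mem_image]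
  constructor
  · rintro (⟨a, ha, h⟩ | ⟨a, ha, h⟩)
    · exact ⟨a, ha, Or.inl h⟩
    · exact ⟨a, ha, Or.inr h⟩
  · rintro ⟨a, ha, h | h⟩
    · exact Or.inl ⟨a, ha, h⟩
    · exact Or.inr ⟨a, ha, h⟩

lemma isUnmatched_iff {M : Finset (ℕ × ℕ)} {v : ℕ} : IsUnmatched M v ↔ v ∉ cov M := by
  rw [mem_cov]
  push Not
  rfl

lemma cov_insert (M : Finset (ℕ × ℕ)) (u v : ℕ) :
    cov (insert (min u v, max u v) M) = insert u (insert v (cov M)) := by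
  rcases le_total u v with h | h <;> ext w <;>
    simp only [cov, h, min_eq_left, min_eq_right, max_eq_left, max_eq_right, Finset.image_insert,
      Finset.mem_union, Finset.mem_insert] <;> tauto

lemma exists_matchNearest_eq {n : ℕ} {next : ℕ → ℕ} {M : Finset (ℕ × ℕ)} {v : ℕ}
    (h : ∃ m < 2 * n - 1, next^[m] (next v) ∉ cov M) :
    ∃ m < 2 * n - 1, next^[m] (next v) ∉ cov M ∧ (∀ j < m, next^[j] (next v) ∈ cov M) ∧
      matchNearest n next M v =
        insert (min (next^[m] (next v)) v, max (next^[m] (next v)) v) M := by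
  rcases hf : (List.iterate next (next v) (2 * n - 1)).find? (fun u => IsUnmatched M u) with _ | u
  · obtain ⟨m, hm, hu⟩ := h
    rw [List.find?_eq_none] at hf
    refine absurd hu ?_
    have := hf _ (List.mem_iterate.2 ⟨m, hm, rfl⟩)
    simpa [isUnmatched_iff] using this
  · obtain ⟨hu, m, hm, rfl, hj⟩ := List.find?_eq_some_iff_getElem.1 hf
    rw [List.length_iterate] at hm
    refine ⟨m, hm, ?_, fun j hjm => ?_, ?_⟩
    · simpa [isUnmatched_iff] using hu
    · simpa [isUnmatched_iff] using hj j hjm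
    · rw [matchNearest, hf]
      simp

lemma iterate_ccwNext {n v : ℕ} (h1 : 1 ≤ v) (h2 : v ≤ 2 * n) {m : ℕ} (hm : m < 2 * n) :
    (ccwNext n)^[m] (ccwNext n v) = if m + 1 < v then v - (m + 1) else 2 * n + v - (m + 1) := by
  induction m with
  | zero => simp only [Function.iterate_zero, id, ccwNext]; split_ifs <;> omega
  | succ m ih =>
    rw [Function.iterate_succ_apply', ih (by omega), ccwNext]
    split_ifs <;> omega

lemma iterate_cwNext {n v : ℕ} (h1 : 1 ≤ v) (h2 : v ≤ 2 * n) {m : ℕ} (hm : m < 2 * n) :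
    (cwNext n)^[m] (cwNext n v) =
      if v + m + 1 ≤ 2 * n then v + m + 1 else v + m + 1 - 2 * n := by
  induction m with
  | zero => simp only [Function.iterate_zero, id, cwNext]; split_ifs <;> omega
  | succ m ih =>
    rw [Function.iterate_succ_apply', ih (by omega), cwNext]
    split_ifs <;> omega

lemma matchNearest_ccw {n v : ℕ} {M : Finset (ℕ × ℕ)} (h1 : 1 ≤ v) (h2 : v ≤ 2 * n)
    (h : ∃ u, 1 ≤ u ∧ u ≤ 2 * n ∧ u ≠ v ∧ u ∉ cov M) :
    ∃ u, 1 ≤ u ∧ u ≤ 2 * n ∧ u ≠ v ∧ u ∉ cov M ∧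
      matchNearest n (ccwNext n) M v = insert (min u v, max u v) M ∧
      ((u < v ∧ ∀ w, u < w → w < v → w ∈ cov M) ∨
        (v < u ∧ (∀ w, 1 ≤ w → w < v → w ∈ cov M) ∧ ∀ w, u < w → w ≤ 2 * n → w ∈ cov M)) := by
  obtain ⟨u₀, a1, a2, a3, a4⟩ := h
  obtain ⟨m, hm, hu, hj, heq⟩ := exists_matchNearest_eq (n := n) (next := ccwNext n) (M := M)
    (v := v) (by
      rcases lt_or_gt_of_ne a3 with hlt | hlt
      · refine ⟨v - u₀ - 1, by omega, ?_⟩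
        rw [iterate_ccwNext h1 h2 (by omega), if_pos (by omega)]
        rwa [show v - (v - u₀ - 1 + 1) = u₀ by omega]
      · refine ⟨2 * n + v - u₀ - 1, by omega, ?_⟩
        rw [iterate_ccwNext h1 h2 (by omega), if_neg (by omega)]
        rwa [show 2 * n + v - (2 * n + v - u₀ - 1 + 1) = u₀ by omega])
  rw [iterate_ccwNext h1 h2 (by omega)] at hu heq
  have hj' : ∀ j < m, (if j + 1 < v then v - (j + 1) else 2 * n + v - (j + 1)) ∈ cov M :=
    fun j hjm => by
      have := hj j hjm
      rwa [iterate_ccwNext h1 h2 (by omega)] at this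
  refine ⟨_, ?_, ?_, ?_, hu, heq, ?_⟩
  · split_ifs <;> omega
  · split_ifs <;> omega
  · split_ifs <;> omega
  · split_ifs with hc
    · refine Or.inl ⟨by omega, fun w w1 w2 => ?_⟩
      have := hj' (v - w - 1) (by omega)
      rwa [if_pos (by omega), show v - (v - w - 1 + 1) = w by omega] at this
    · refine Or.inr ⟨by omega, fun w w1 w2 => ?_, fun w w1 w2 => ?_⟩
      · have := hj' (v - w - 1) (by omega)
        rwa [if_pos (by omega), show v - (v - w - 1 + 1) = w by omega] at this
      · have := hj' (2 * n + v - w - 1) (by omega)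
        rwa [if_neg (by omega), show 2 * n + v - (2 * n + v - w - 1 + 1) = w by omega] at this

lemma matchNearest_cw {n v : ℕ} {M : Finset (ℕ × ℕ)} (h1 : 1 ≤ v) (h2 : v ≤ 2 * n)
    (h : ∃ u, 1 ≤ u ∧ u ≤ 2 * n ∧ u ≠ v ∧ u ∉ cov M) :
    ∃ u, 1 ≤ u ∧ u ≤ 2 * n ∧ u ≠ v ∧ u ∉ cov M ∧
      matchNearest n (cwNext n) M v = insert (min u v, max u v) M ∧
      ((v < u ∧ ∀ w, v < w → w < u → w ∈ cov M) ∨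
        (u < v ∧ (∀ w, 1 ≤ w → w < u → w ∈ cov M) ∧ ∀ w, v < w → w ≤ 2 * n → w ∈ cov M)) := by
  obtain ⟨u₀, a1, a2, a3, a4⟩ := h
  obtain ⟨m, hm, hu, hj, heq⟩ := exists_matchNearest_eq (n := n) (next := cwNext n) (M := M)
    (v := v) (by
      rcases lt_or_gt_of_ne a3 with hlt | hlt
      · refine ⟨2 * n + u₀ - v - 1, by omega, ?_⟩
        rw [iterate_cwNext h1 h2 (by omega), if_neg (by omega)]
        rwa [show v + (2 * n + u₀ - v - 1) + 1 - 2 * n = u₀ by omega]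
      · refine ⟨u₀ - v - 1, by omega, ?_⟩
        rw [iterate_cwNext h1 h2 (by omega), if_pos (by omega)]
        rwa [show v + (u₀ - v - 1) + 1 = u₀ by omega])
  rw [iterate_cwNext h1 h2 (by omega)] at hu heq
  have hj' : ∀ j < m, (if v + j + 1 ≤ 2 * n then v + j + 1 else v + j + 1 - 2 * n) ∈ cov M :=
    fun j hjm => by
      have := hj j hjm
      rwa [iterate_cwNext h1 h2 (by omega)] at this
  refine ⟨_, ?_, ?_, ?_, hu, heq, ?_⟩
  · split_ifs <;> omega
  · split_ifs <;> omega
  · split_ifs <;> omega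
  · split_ifs with hc
    · refine Or.inl ⟨by omega, fun w w1 w2 => ?_⟩
      have := hj' (w - v - 1) (by omega)
      rwa [if_pos (by omega), show v + (w - v - 1) + 1 = w by omega] at this
    · refine Or.inr ⟨by omega, fun w w1 w2 => ?_, fun w w1 w2 => ?_⟩
      · have := hj' (2 * n + w - v - 1) (by omega)
        rwa [if_neg (by omega), show v + (2 * n + w - v - 1) + 1 - 2 * n = w by omega] at this
      · have := hj' (w - v - 1) (by omega)
        rwa [if_pos (by omega), show v + (w - v - 1) + 1 = w by omega] at this

/-! ### Noncrossing partial matchings -/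

/-- A noncrossing partial matching of `{1, …, 2n}` in which every arc has a side without unmatched
vertices. -/
structure IsPartialMatching (n : ℕ) (M : Finset (ℕ × ℕ)) : Prop where
  arcs : ∀ a ∈ M, 1 ≤ a.1 ∧ a.1 < a.2 ∧ a.2 ≤ 2 * n
  unique : ∀ a ∈ M, ∀ b ∈ M, ∀ v, (a.1 = v ∨ a.2 = v) → (b.1 = v ∨ b.2 = v) → a = b
  side : ∀ a ∈ M, (∀ w, a.1 < w → w < a.2 → w ∈ cov M) ∨
    (∀ w, 1 ≤ w → w ≤ 2 * n → (w < a.1 ∨ a.2 < w) → w ∈ cov M)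
  noncrossing : ∀ a ∈ M, ∀ b ∈ M, ¬ (a.1 < b.1 ∧ b.1 < a.2 ∧ a.2 < b.2)

/-- An arc between two unmatched vertices, one side of which has no unmatched vertices, can be
added: the endpoints of this arc are on the same side of every other arc. -/
lemma IsPartialMatching.insert {n : ℕ} {M : Finset (ℕ × ℕ)} (hM : IsPartialMatching n M) {x y : ℕ}
    (hx1 : 1 ≤ x) (hxy : x < y) (hy : y ≤ 2 * n) (hx : x ∉ cov M) (hyM : y ∉ cov M)
    (hside : (∀ w, x < w → w < y → w ∈ cov M) ∨
      (∀ w, 1 ≤ w → w ≤ 2 * n → (w < x ∨ y < w) → w ∈ cov M)) :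
    IsPartialMatching n (insert (x, y) M) := by
  have hsub : cov M ⊆ cov (Insert.insert (x, y) M) := fun w hw => by
    rw [mem_cov] at hw ⊢
    obtain ⟨a, ha, h⟩ := hw
    exact ⟨a, Finset.mem_insert_of_mem ha, h⟩
  have hno : ∀ a ∈ M, a.1 ≠ x ∧ a.2 ≠ x ∧ a.1 ≠ y ∧ a.2 ≠ y := fun a ha =>
    ⟨fun h => hx (mem_cov.2 ⟨a, ha, Or.inl h⟩), fun h => hx (mem_cov.2 ⟨a, ha, Or.inr h⟩),
      fun h => hyM (mem_cov.2 ⟨a, ha, Or.inl h⟩), fun h => hyM (mem_cov.2 ⟨a, ha, Or.inr h⟩)⟩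
  have hin : ∀ a ∈ M, (a.1 < x ∧ x < a.2 ↔ a.1 < y ∧ y < a.2) := fun a ha => by
    obtain ⟨n1, n2, n3, n4⟩ := hno a ha
    have := hM.arcs a ha
    rcases hM.side a ha with h | h
    · have h1 : ¬ (a.1 < x ∧ x < a.2) := fun hc => hx (h x hc.1 hc.2)
      have h2 : ¬ (a.1 < y ∧ y < a.2) := fun hc => hyM (h y hc.1 hc.2)
      tauto
    · have h1 : ¬ (x < a.1 ∨ a.2 < x) := fun hc => hx (h x (by omega) (by omega) hc)
      have h2 : ¬ (y < a.1 ∨ a.2 < y) := fun hc => hyM (h y (by omega) (by omega) hc)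
      omega
  refine ⟨?_, ?_, ?_, ?_⟩
  · intro a ha
    rcases Finset.mem_insert.1 ha with rfl | ha
    · exact ⟨hx1, hxy, hy⟩
    · exact hM.arcs a ha
  · intro a ha b hb v hav hbv
    rcases Finset.mem_insert.1 ha with rfl | ha <;> rcases Finset.mem_insert.1 hb with rfl | hb
    · rfl
    · have := hno b hb
      simp only at hav
      omega
    · have := hno a ha
      simp only at hbv
      omega
    · exact hM.unique a ha b hb v hav hbv
  · intro a ha
    rcases Finset.mem_insert.1 ha with rfl | ha
    · exact hside.imp (fun h w w1 w2 => hsub (h w w1 w2)) fun h w w1 w2 w3 => hsub (h w w1 w2 w3)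
    · exact (hM.side a ha).imp (fun h w w1 w2 => hsub (h w w1 w2))
        fun h w w1 w2 w3 => hsub (h w w1 w2 w3)
  · intro a ha b hb
    rcases Finset.mem_insert.1 ha with rfl | ha <;> rcases Finset.mem_insert.1 hb with rfl | hb
    · omega
    · have := hin b hb
      have := hno b hb
      simp only
      omega
    · have := hin a ha
      have := hno a ha
      simp only
      omega
    · exact hM.noncrossing a ha b hb

/-! ### The Armstrong–Stump–Thomas map in terms of permutations -/

/-- The matching after `k` steps of the Armstrong–Stump–Thomas map, for the antichain that comes
from the excedances of the permutation with values `p 1, …, p n`. -/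
def ast (n : ℕ) (p : ℕ → ℕ) : ℕ → Finset (ℕ × ℕ)
  | 0 => ∅
  | k + 1 =>
    if k + 1 < p (k + 1) then matchNearest n (ccwNext n) (ast n p k) (p (k + 1))
    else matchNearest n (cwNext n) (ast n p k) (2 * n + 1 - (k + 1))

lemma astStep_Exc {n : ℕ} (π : Equiv.Perm (Fin n)) (M : Finset (ℕ × ℕ)) {k : ℕ} (hk : k < n) :
    astStep n (Exc π) M (k + 1) =
      if k + 1 < letter π (k + 1) then matchNearest n (ccwNext n) M (letter π (k + 1))
      else matchNearest n (cwNext n) M (2 * n + 1 - (k + 1)) := by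
  have hl := letter_succ (π := π) ⟨k, hk⟩
  simp only at hl
  have hiff : ∀ j, (∃ I ∈ Exc π, I.fst = k + 1 ∧ I.snd + 1 = j) ↔
      k + 1 < letter π (k + 1) ∧ j = letter π (k + 1) := fun j => by
    constructor
    · rintro ⟨I, hI, h1, rfl⟩
      obtain ⟨i, hi, h3, h4⟩ := mem_Exc.1 hI
      have : i = ⟨k, hk⟩ := Fin.ext (by simp; omega)
      subst this
      rw [Fin.lt_def] at hi
      simp only at hi
      omega
    · rintro ⟨h1, rfl⟩
      have hi : (⟨k, hk⟩ : Fin n) < π ⟨k, hk⟩ := Fin.lt_def.2 (by simp only; omega)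
      exact ⟨excInterval π _ hi, mem_Exc.2 ⟨_, hi, rfl, rfl⟩, rfl, hl.symm⟩
  rw [astStep]
  rcases hf : (List.range' 1 n).find? (fun j => ∃ I ∈ Exc π, I.fst = k + 1 ∧ I.snd + 1 = j)
    with _ | j
  · rw [List.find?_eq_none] at hf
    rw [if_neg]
    intro hlt
    refine hf (letter π (k + 1)) ?_ ?_
    · rw [List.mem_range'_1]; omega
    · rw [decide_eq_true_eq, hiff]
      exact ⟨hlt, rfl⟩
  · have := List.find?_some hf
    rw [decide_eq_true_eq, hiff] at this
    rw [if_pos this.1, this.2]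

lemma AST_Exc {n : ℕ} (π : Equiv.Perm (Fin n)) : AST n (Exc π) = ast n (letter π) n := by
  have key : ∀ m, m ≤ n → (List.range' 1 m).foldl (astStep n (Exc π)) ∅ = ast n (letter π) m := by
    intro m hm
    induction m with
    | zero => rfl
    | succ m ih =>
      rw [List.range'_concat, List.foldl_append, ih (by omega), List.foldl_cons, List.foldl_nil,
        show 1 + 1 * m = m + 1 by ring, astStep_Exc π _ hm, ast]
  exact key n le_rfl

/-- Step `k + 1` of the Armstrong–Stump–Thomas map starts from the unmatched vertex `v`, and `u` is
the nearest unmatched vertex in the direction of this step. The two alternatives for each direction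
are whether `u` is found before or after passing the point between `2n` and `1`; in the latter case
`u` is one of the times up to `k + 1`, respectively one of the values up to `k + 1`. -/
def IsStep (n : ℕ) (p : ℕ → ℕ) (k : ℕ) (M : Finset (ℕ × ℕ)) (u v : ℕ) : Prop :=
  u ∉ cov M ∧ v ∉ cov M ∧ 1 ≤ u ∧ u ≤ 2 * n ∧
  ((k + 1 < p (k + 1) ∧ v = p (k + 1) ∧
      ((u < v ∧ ∀ w, u < w → w < v → w ∈ cov M) ∨
        (2 * n - k ≤ u ∧ (∀ w, 1 ≤ w → w < v → w ∈ cov M) ∧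
          ∀ w, u < w → w ≤ 2 * n → w ∈ cov M))) ∨
    (p (k + 1) ≤ k + 1 ∧ v = 2 * n - k ∧
      ((v < u ∧ ∀ w, v < w → w < u → w ∈ cov M) ∨
        (u ≤ k + 1 ∧ (∀ w, 1 ≤ w → w < u → w ∈ cov M) ∧ ∀ w, v < w → w ≤ 2 * n → w ∈ cov M))))

/-- The properties of the matching `M` after `k` steps of the Armstrong–Stump–Thomas map: where the
matched vertices are, that the starting vertices of these steps are among them, and how many of them
are in `1, …, n`. -/
structure ASTInvariant (n : ℕ) (p : ℕ → ℕ) (k : ℕ) (M : Finset (ℕ × ℕ)) : Prop where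
  partialMatching : IsPartialMatching n M
  card_cov : (cov M).card = 2 * k
  values : ∀ v ∈ cov M, v ≤ n → v ≤ k ∨ ∃ j, 1 ≤ j ∧ j ≤ k ∧ j < p j ∧ v ≤ p j
  times : ∀ v ∈ cov M, n < v → 2 * n + 1 - k ≤ v
  exc_mem : ∀ j, 1 ≤ j → j ≤ k → j < p j → p j ∈ cov M
  nonexc_mem : ∀ j, 1 ≤ j → j ≤ k → p j ≤ j → 2 * n + 1 - j ∈ cov M
  card_values : ((cov M).filter (· ≤ n)).card = k + (doomed n p k).card

/-- The vertex `v` carries an up step of the Dyck path of the permutation. -/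
def IsUp (n : ℕ) (p : ℕ → ℕ) (v : ℕ) : Prop :=
  if v ≤ n then v ∈ row p n else bump p (2 * n + 1 - v) ≠ none

section Steps

variable {n : ℕ} {p : ℕ → ℕ} {k : ℕ} {M : Finset (ℕ × ℕ)}

lemma ASTInvariant.mem_range (hM : ASTInvariant n p k M) {v : ℕ} (hv : v ∈ cov M) :
    1 ≤ v ∧ v ≤ 2 * n := by
  obtain ⟨a, ha, h⟩ := mem_cov.1 hv
  have := hM.partialMatching.arcs a ha
  omega

lemma ASTInvariant.lt_exc (h : IsWord321 n p) (hM : ASTInvariant n p k M) (hk : k < n)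
    (he : k + 1 < p (k + 1)) {v : ℕ} (hv : v ∈ cov M) (hvn : v ≤ n) : v < p (k + 1) := by
  rcases hM.values v hv hvn with h1 | ⟨j, j1, j2, j3, j4⟩
  · omega
  · have := h.exc j (k + 1) j1 (by omega) hk he
    omega

/-- The vertices that a step may reach are too many to be all matched. -/
lemma ASTInvariant.exists_unmatched (hM : ASTInvariant n p k M) {a b : ℕ} (ha : a < b)
    (hb : b ≤ 2 * n) (hcard : 2 * k < a + (2 * n - b)) :
    ∃ u, 1 ≤ u ∧ u ≤ 2 * n ∧ (u ≤ a ∨ b < u) ∧ u ∉ cov M := by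
  by_contra hc
  push Not at hc
  have hsub : Finset.Icc 1 a ∪ Finset.Ioc b (2 * n) ⊆ cov M := fun u hu => by
    simp only [Finset.mem_union, Finset.mem_Icc, Finset.mem_Ioc] at hu
    exact hc u (by omega) (by omega) (by omega)
  have h1 := Finset.card_le_card hsub
  rw [Finset.card_union_of_disjoint, Nat.card_Icc, Nat.card_Ioc, hM.card_cov] at h1
  · omega
  · rw [Finset.disjoint_left]
    intro u hu hu'
    simp only [Finset.mem_Icc, Finset.mem_Ioc] at hu hu'
    omega

lemma ASTInvariant.exists_isStep (h : IsWord321 n p) (hk : k < n)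
    (hM : ASTInvariant n p k (ast n p k)) :
    ∃ u v, IsStep n p k (ast n p k) u v ∧
      ast n p (k + 1) = insert (min u v, max u v) (ast n p k) := by
  have hr := h.range (k + 1) (by omega) hk
  rw [ast]
  split_ifs with he
  · obtain ⟨u₀, a1, a2, a3, a4⟩ := hM.exists_unmatched (a := p (k + 1) - 1) (b := 2 * n - (k + 1))
      (by omega) (by omega) (by omega)
    have hv : p (k + 1) ∉ cov (ast n p k) := fun hc =>
      lt_irrefl _ (hM.lt_exc h hk he hc hr.2)
    obtain ⟨u, b1, b2, b3, b4, b5, b6⟩ := matchNearest_ccw (n := n) (v := p (k + 1))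
      (M := ast n p k) hr.1 (by omega) ⟨u₀, a1, a2, by omega, a4⟩
    refine ⟨u, _, ⟨b4, hv, b1, b2, Or.inl ⟨he, rfl, b6.imp id fun b => ⟨?_, b.2⟩⟩⟩, b5⟩
    by_contra hc
    rcases a3 with a3 | a3
    · exact a4 (b.2.1 u₀ a1 (by omega))
    · exact a4 (b.2.2 u₀ (by omega) a2)
  · obtain ⟨u₀, a1, a2, a3, a4⟩ := hM.exists_unmatched (a := k + 1) (b := 2 * n - k)
      (by omega) (by omega) (by omega)
    have hv : 2 * n + 1 - (k + 1) ∉ cov (ast n p k) := fun hc => by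
      have := hM.times _ hc (by omega)
      omega
    obtain ⟨u, b1, b2, b3, b4, b5, b6⟩ := matchNearest_cw (n := n) (v := 2 * n + 1 - (k + 1))
      (M := ast n p k) (by omega) (by omega) ⟨u₀, a1, a2, by omega, a4⟩
    refine ⟨u, _, ⟨b4, hv, b1, b2, Or.inr ⟨by omega, by omega, b6.imp id fun b => ⟨?_, b.2⟩⟩⟩, b5⟩
    by_contra hc
    rcases a3 with a3 | a3
    · exact a4 (b.2.1 u₀ a1 (by omega))
    · exact a4 (b.2.2 u₀ (by omega) a2)

lemma ASTInvariant.mem_row_of_not_mem (h : IsWord321 n p) (hM : ASTInvariant n p k M) {u : ℕ}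
    (hu1 : 1 ≤ u) (hun : u ≤ n) (hu : u ∉ cov M) (hlt : ∀ j, k < j → j ≤ n → j < p j → u < p j) :
    u ∈ row p n := by
  obtain ⟨j, j1, j2, rfl⟩ := h.surj u hu1 hun
  by_cases he : j < p j
  · rcases le_or_gt j k with hjk | hjk
    · exact absurd (hM.exc_mem j j1 hjk he) hu
    · exact absurd (hlt j hjk j2 he) (lt_irrefl _)
  · exact h.nonexc_mem_row j1 j2 le_rfl (by omega)

lemma ASTInvariant.bump_eq_none (h : IsWord321 n p) (hM : ASTInvariant n p k M) {j : ℕ}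
    (hj : 1 ≤ j) (hjk : j ≤ k) (hkn : k ≤ n) (hu : 2 * n + 1 - j ∉ cov M) : bump p j = none := by
  have he : j < p j := by
    by_contra hc
    exact hu (hM.nonexc_mem j hj hjk (by omega))
  obtain ⟨j, rfl⟩ := Nat.exists_eq_add_of_le' hj
  exact h.bump_exc (by omega) he

lemma ASTInvariant.card_times (hM : ASTInvariant n p k M) :
    ((cov M).filter (n < ·)).card + (doomed n p k).card = k := by
  have h1 := Finset.card_filter_add_card_filter_not (s := cov M) (· ≤ n)
  simp only [not_le] at h1
  have := hM.card_cov
  have := hM.card_values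
  omega

/-- The arc added by a step starts with an up step and ends with a down step. By the count of
matched vertices, an excedance value is matched with a smaller value exactly if it is bumped later,
and the time of another letter is matched with an earlier time exactly if this letter bumps. -/
lemma IsStep.isUp (h : IsWord321 n p) (hk : k < n) (hM : ASTInvariant n p k M) {u v : ℕ}
    (hs : IsStep n p k M u v) : IsUp n p (min u v) ∧ ¬ IsUp n p (max u v) ∧
      ((u ≤ n ∧ v ≤ n ∧ (doomed n p (k + 1)).card = (doomed n p k).card + 1) ∨
       (u ≤ n ∧ n < v ∧ (doomed n p (k + 1)).card = (doomed n p k).card) ∨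
       (n < u ∧ v ≤ n ∧ (doomed n p (k + 1)).card = (doomed n p k).card) ∨
       (n < u ∧ n < v ∧ (doomed n p (k + 1)).card + 1 = (doomed n p k).card)) := by
  have hr := h.range (k + 1) (by omega) hk
  obtain ⟨hu, hv, hu1, hu2, ⟨he, rfl, ⟨hlt, hin⟩ | ⟨hge, hin, hout⟩⟩ |
    ⟨he, rfl, ⟨hlt, hin⟩ | ⟨hge, hin, hout⟩⟩⟩ := hs
  · -- an excedance value and a smaller value
    have hrow : p (k + 1) ∉ row p n := by
      rw [h.exc_not_mem_row_iff hk he]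
      have hsub : (cov M).filter (· ≤ n) ⊆ (Finset.Ico 1 (p (k + 1))).erase u := fun w hw => by
        rw [Finset.mem_filter] at hw
        rw [Finset.mem_erase, Finset.mem_Ico]
        exact ⟨fun hwu => hu (hwu ▸ hw.1), (hM.mem_range hw.1).1, hM.lt_exc h hk he hw.1 hw.2⟩
      have h1 := Finset.card_le_card hsub
      rw [hM.card_values, Finset.card_erase_of_mem (by simp; omega), Nat.card_Ico] at h1
      omega
    have hd := h.card_doomed_exc hk he
    rw [if_neg hrow] at hd
    rw [min_eq_left hlt.le, max_eq_right hlt.le, IsUp, IsUp, if_pos hr.2, if_pos (by omega)]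
    refine ⟨hM.mem_row_of_not_mem h hu1 (by omega) hu fun j j1 j2 j3 => ?_, hrow, by omega⟩
    rcases (Nat.succ_le_of_lt j1).eq_or_lt with rfl | hj
    · exact hlt
    · have := h.exc (k + 1) j (by omega) hj j2 j3
      omega
  · -- an excedance value and a time
    have hrow : p (k + 1) ∈ row p n := by
      by_contra hc
      rw [h.exc_not_mem_row_iff hk he] at hc
      have hsub : Finset.Ico 1 (p (k + 1)) ⊆ (cov M).filter (· ≤ n) := fun w hw => by
        rw [Finset.mem_Ico] at hw
        rw [Finset.mem_filter]
        exact ⟨hin w hw.1 hw.2, by omega⟩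
      have h1 := Finset.card_le_card hsub
      rw [hM.card_values, Nat.card_Ico] at h1
      omega
    have hd := h.card_doomed_exc hk he
    rw [if_pos hrow] at hd
    rw [min_eq_right (by omega), max_eq_left (by omega), IsUp, IsUp, if_pos hr.2,
      if_neg (by omega)]
    refine ⟨hrow, not_not.2 ?_, by omega⟩
    rcases hge.eq_or_lt with heq | hgt
    · rw [show 2 * n + 1 - u = k + 1 by omega]
      exact h.bump_exc hk he
    · refine hM.bump_eq_none h (by omega) (by omega) hk.le ?_
      rwa [show 2 * n + 1 - (2 * n + 1 - u) = u by omega]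
  · -- two times
    have hb : bump p (k + 1) ≠ none := fun hb => by
      have h0 := (h.card_doomed_nonexc_none hk he hb).1
      have h1 := hM.card_times
      have hsub : (cov M).filter (n < ·) ⊆ (Finset.Ioc (2 * n - k) (2 * n)).erase u :=
        fun w hw => by
          rw [Finset.mem_filter] at hw
          rw [Finset.mem_erase, Finset.mem_Ioc]
          have := hM.times w hw.1 hw.2
          exact ⟨fun hwu => hu (hwu ▸ hw.1), by omega, (hM.mem_range hw.1).2⟩
      have h2 := Finset.card_le_card hsub
      rw [Finset.card_erase_of_mem (by simp; omega), Nat.card_Ioc] at h2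
      omega
    obtain ⟨y, hy⟩ := Option.ne_none_iff_exists'.1 hb
    have hd := h.card_doomed_nonexc_some hk he hy
    rw [min_eq_right (by omega), max_eq_left (by omega), IsUp, IsUp, if_neg (by omega),
      if_neg (by omega), show 2 * n + 1 - (2 * n - k) = k + 1 by omega]
    refine ⟨hb, not_not.2 (hM.bump_eq_none h (by omega) (by omega) hk.le ?_), by omega⟩
    rwa [show 2 * n + 1 - (2 * n + 1 - u) = u by omega]
  · -- a time and a value
    have h1 := hM.card_times
    have hb : bump p (k + 1) = none := by
      rcases hb : bump p (k + 1) with _ | y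
      · rfl
      · have hd := h.card_doomed_nonexc_some hk he hb
        have hsub : Finset.Ioc (2 * n - k) (2 * n) ⊆ (cov M).filter (n < ·) := fun w hw => by
          rw [Finset.mem_Ioc] at hw
          rw [Finset.mem_filter]
          exact ⟨hout w hw.1 hw.2, by omega⟩
        have h2 := Finset.card_le_card hsub
        rw [Nat.card_Ioc] at h2
        omega
    have hd := h.card_doomed_nonexc_none hk he hb
    rw [min_eq_left (by omega), max_eq_right (by omega), IsUp, IsUp, if_pos (by omega),
      if_neg (by omega), show 2 * n + 1 - (2 * n - k) = k + 1 by omega]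
    exact ⟨hM.mem_row_of_not_mem h hu1 (by omega) hu fun j j1 j2 j3 => by omega, not_not.2 hb,
      by omega⟩

lemma IsStep.ne {u v : ℕ} (hk : k < n) (h : IsWord321 n p) (hs : IsStep n p k M u v) : u ≠ v := by
  have hr := h.range (k + 1) (by omega) hk
  obtain ⟨hu, hv, hu1, hu2, hs⟩ := hs
  omega

lemma ASTInvariant.step (h : IsWord321 n p) (hk : k < n) (hM : ASTInvariant n p k M) {u v : ℕ}
    (hs : IsStep n p k M u v) : ASTInvariant n p (k + 1) (insert (min u v, max u v) M) := by
  have hr := h.range (k + 1) (by omega) hk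
  have hne := hs.ne hk h
  have hup := (hs.isUp h hk hM).2.2
  obtain ⟨hu, hv, hu1, hu2, hs⟩ := hs
  have hu' : u ∉ insert v (cov M) := by simp [hne, hu]
  refine ⟨?_, ?_, ?_, ?_, ?_, ?_, ?_⟩
  · refine hM.partialMatching.insert (by omega) (by omega) (by omega) ?_ ?_ ?_
    · rcases min_choice u v with e | e <;> rwa [e]
    · rcases max_choice u v with e | e <;> rwa [e]
    · rcases hs with ⟨he, hv', ⟨hlt, hin⟩ | ⟨hge, hin, hout⟩⟩ |
        ⟨he, hv', ⟨hlt, hin⟩ | ⟨hge, hin, hout⟩⟩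
      · rw [min_eq_left hlt.le, max_eq_right hlt.le]
        exact Or.inl hin
      · rw [min_eq_right (by omega), max_eq_left (by omega)]
        exact Or.inr fun w w1 w2 w3 => w3.elim (hin w w1) fun w3 => hout w w3 w2
      · rw [min_eq_right hlt.le, max_eq_left hlt.le]
        exact Or.inl hin
      · rw [min_eq_left (by omega), max_eq_right (by omega)]
        exact Or.inr fun w w1 w2 w3 => w3.elim (hin w w1) fun w3 => hout w w3 w2
  · rw [cov_insert, Finset.card_insert_of_notMem hu', Finset.card_insert_of_notMem hv,
      hM.card_cov]
    ring
  · intro w hw hwn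
    rw [cov_insert, Finset.mem_insert, Finset.mem_insert] at hw
    have hnew : w = u ∨ w = v → w ≤ k + 1 ∨ (k + 1 < p (k + 1) ∧ w ≤ p (k + 1)) := by omega
    rcases or_assoc.2 hw with hw | hw
    · rcases hnew hw with h1 | h1
      · exact Or.inl h1
      · exact Or.inr ⟨k + 1, by omega, le_rfl, h1⟩
    · rcases hM.values w hw hwn with h1 | ⟨j, j1, j2, j3⟩
      · exact Or.inl (by omega)
      · exact Or.inr ⟨j, j1, by omega, j3⟩
  · intro w hw hwn
    rw [cov_insert, Finset.mem_insert, Finset.mem_insert] at hw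
    rcases or_assoc.2 hw with hw | hw
    · omega
    · have := hM.times w hw hwn
      omega
  · intro j j1 j2 j3
    rw [cov_insert, Finset.mem_insert, Finset.mem_insert]
    rcases j2.eq_or_lt with rfl | hj
    · right; left; omega
    · exact Or.inr (Or.inr (hM.exc_mem j j1 (by omega) j3))
  · intro j j1 j2 j3
    rw [cov_insert, Finset.mem_insert, Finset.mem_insert]
    rcases j2.eq_or_lt with rfl | hj
    · right; left; omega
    · exact Or.inr (Or.inr (hM.nonexc_mem j j1 (by omega) j3))
  · have hc := hM.card_values
    have hv'' : v ∉ (cov M).filter (· ≤ n) := fun hc => hv (Finset.mem_filter.1 hc).1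
    have hu'' : u ∉ (cov M).filter (· ≤ n) := fun hc => hu (Finset.mem_filter.1 hc).1
    have hu''' : u ∉ insert v ((cov M).filter (· ≤ n)) := by
      rw [Finset.mem_insert, not_or]; exact ⟨hne, hu''⟩
    rw [cov_insert, Finset.filter_insert, Finset.filter_insert]
    rcases hup with ⟨a1, a2, a3⟩ | ⟨a1, a2, a3⟩ | ⟨a1, a2, a3⟩ | ⟨a1, a2, a3⟩
    · rw [if_pos a1, if_pos a2, Finset.card_insert_of_notMem hu''',
        Finset.card_insert_of_notMem hv'']
      omega
    · rw [if_pos a1, if_neg (by omega), Finset.card_insert_of_notMem hu'']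
      omega
    · rw [if_neg (by omega), if_pos a2, Finset.card_insert_of_notMem hv'']
      omega
    · rw [if_neg (by omega), if_neg (by omega)]
      omega

lemma astInvariant (h : IsWord321 n p) (hk : k ≤ n) : ASTInvariant n p k (ast n p k) := by
  induction k with
  | zero =>
    refine ⟨⟨?_, ?_, ?_, ?_⟩, ?_, ?_, ?_, ?_, ?_, ?_⟩ <;> simp [ast, cov, doomed, row] <;> omega
  | succ k ih =>
    obtain ⟨u, v, hs, he⟩ := (ih (by omega)).exists_isStep h hk
    rw [he]
    exact (ih (by omega)).step h hk hs

lemma ast_mono (h : IsWord321 n p) {m : ℕ} (hkm : k ≤ m) (hm : m ≤ n) :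
    ast n p k ⊆ ast n p m := by
  induction m, hkm using Nat.le_induction with
  | base => exact subset_rfl
  | succ m hkm ih =>
    obtain ⟨u, v, hs, he⟩ := (astInvariant h (show m ≤ n by omega)).exists_isStep h hm
    rw [he]
    exact (ih (by omega)).trans (Finset.subset_insert _ _)

lemma exists_step_of_mem_ast (h : IsWord321 n p) (hk : k ≤ n) {a : ℕ × ℕ} (ha : a ∈ ast n p k) :
    ∃ m < k, ∃ u v, IsStep n p m (ast n p m) u v ∧ a = (min u v, max u v) ∧
      a ∈ ast n p (m + 1) := by
  induction k with
  | zero => simp [ast] at ha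
  | succ k ih =>
    obtain ⟨u, v, hs, he⟩ := (astInvariant h (show k ≤ n by omega)).exists_isStep h hk
    have ha' := ha
    rw [he, Finset.mem_insert] at ha
    rcases ha with ha | ha
    · exact ⟨k, by omega, u, v, hs, ha, ha'⟩
    · obtain ⟨m, h1, h2⟩ := ih (by omega) ha
      exact ⟨m, by omega, h2⟩

lemma ast_mem_ncMatchings (h : IsWord321 n p) : ast n p n ∈ ncMatchings n := by
  have hI := astInvariant h le_rfl
  have hcov : cov (ast n p n) = Finset.Icc 1 (2 * n) := by
    refine Finset.eq_of_subset_of_card_le (fun v hv => ?_) ?_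
    · rw [Finset.mem_Icc]; exact hI.mem_range hv
    · rw [hI.card_cov, Nat.card_Icc]; omega
  refine ⟨hI.partialMatching.arcs, fun v h1 h2 => ?_, ?_⟩
  · have hv : v ∈ cov (ast n p n) := by rw [hcov, Finset.mem_Icc]; exact ⟨h1, h2⟩
    obtain ⟨a, ha, hav⟩ := mem_cov.1 hv
    exact ⟨a, ⟨ha, hav⟩, fun b hb => hI.partialMatching.unique b hb.1 a ha v hb.2 hav⟩
  · rintro ⟨i, j, k, l, h1, h2, h3, h4, h5⟩
    exact hI.partialMatching.noncrossing _ h4 _ h5 ⟨h1, h2, h3⟩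

/-- At the first excedance where `p` and `q` differ, the resulting matchings differ: where `q` has
the smaller value, it starts its step from a vertex that is still unmatched for `p`, and for `p`
this vertex gets a partner which lies in the direction opposite to the one for `q`. -/
lemma ast_ne_of_lt {q : ℕ → ℕ} (hp : IsWord321 n p) (hq : IsWord321 n q) (hk : k < n)
    (hagree : ∀ j, 1 ≤ j → j ≤ k → (j < p j ↔ j < q j) ∧ (j < p j → p j = q j))
    (he : k + 1 < p (k + 1)) (hlt : q (k + 1) < p (k + 1)) : ast n p n ≠ ast n q n := by
  intro heq
  have hIp := astInvariant hp hk.le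
  have hrp := hp.range (k + 1) (by omega) hk
  obtain ⟨u, v, hs, hins⟩ := (astInvariant hq hk.le).exists_isStep hq hk
  have hne := hs.ne hk hq
  obtain ⟨-, -, hu1, hu2, hs⟩ := hs
  have hv : v ∉ cov (ast n p k) := fun hv => by
    rcases hs with ⟨he', rfl, -⟩ | ⟨he', rfl, -⟩
    · rcases hIp.values _ hv (hq.range (k + 1) (by omega) hk).2 with h1 | ⟨j, j1, j2, j3, j4⟩
      · omega
      · have := (hagree j j1 j2).2 j3
        have := hq.exc j (k + 1) j1 (by omega) hk he'
        omega
    · have := hIp.times _ hv (by omega)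
      omega
  have hmem : (min u v, max u v) ∈ ast n p n := by
    rw [heq]
    refine ast_mono hq (show k + 1 ≤ n by omega) le_rfl ?_
    rw [hins]
    exact Finset.mem_insert_self _ _
  obtain ⟨m, hm, u', v', hs', harc, hmem'⟩ := exists_step_of_mem_ast hp le_rfl hmem
  have hne' := hs'.ne hm hp
  have hkm : k ≤ m := by
    by_contra hc
    refine hv (mem_cov.2 ⟨_, ast_mono hp (show m + 1 ≤ k by omega) hk.le hmem', ?_⟩)
    simp only
    omega
  have hexc : m = k ∨ k < m ∧ (m + 1 < p (m + 1) → p (k + 1) < p (m + 1)) := by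
    rcases hkm.eq_or_lt with h | h
    · exact Or.inl h.symm
    · exact Or.inr ⟨h, fun he' => hp.exc (k + 1) (m + 1) (by omega) (by omega) hm he'⟩
  have hrm := hp.range (m + 1) (by omega) hm
  obtain ⟨-, -, -, -, hs'⟩ := hs'
  rw [Prod.mk.injEq] at harc
  have hs1 : (k + 1 < q (k + 1) ∧ v = q (k + 1) ∧ (u < v ∨ 2 * n - k ≤ u)) ∨
      (q (k + 1) ≤ k + 1 ∧ v = 2 * n - k ∧ (v < u ∨ u ≤ k + 1)) :=
    hs.imp (fun a => ⟨a.1, a.2.1, a.2.2.imp And.left And.left⟩)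
      fun a => ⟨a.1, a.2.1, a.2.2.imp And.left And.left⟩
  have hs2 : (m + 1 < p (m + 1) ∧ v' = p (m + 1)) ∨
      (p (m + 1) ≤ m + 1 ∧ v' = 2 * n - m) :=
    hs'.imp (fun a => ⟨a.1, a.2.1⟩) fun a => ⟨a.1, a.2.1⟩
  clear hs hs'
  rcases hexc with rfl | hexc
  · omega
  · omega

end Steps

/-! ### Bijectivity and the composition -/

section Bijections

variable {n : ℕ} {π σ : Equiv.Perm (Fin n)}

lemma isUp_iff_RSKD {v : ℕ} (h1 : 1 ≤ v) (h2 : v ≤ 2 * n) :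
    (IsUp n (letter π) v → (RSKD π)[v - 1]? = some DyckStep.U) ∧
      (¬ IsUp n (letter π) v → (RSKD π)[v - 1]? = some DyckStep.D) := by
  rw [IsUp]
  split_ifs with hv
  · rw [RSKD_getElem?_value h1 hv]
    exact ⟨fun h => by rw [if_pos h], fun h => by rw [if_neg h]⟩
  · have := RSKD_getElem?_time (π := π) (k := 2 * n + 1 - v) (by omega) (by omega)
    rw [show 2 * n + 1 - (2 * n + 1 - v) - 1 = v - 1 by omega] at this
    rw [this]
    exact ⟨fun h => by rw [if_neg h], fun h => by rw [if_pos (not_not.1 h)]⟩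

lemma labels_RSKD_AST (hπ : π ∈ perms321 n) : Labels (RSKD π) (AST n (Exc π)) := by
  have hw := isWord321_letter hπ
  rw [AST_Exc]
  intro a ha
  have hr := (ast_mem_ncMatchings hw).1 a ha
  obtain ⟨k, hk, u, v, hs, rfl, -⟩ := exists_step_of_mem_ast hw le_rfl ha
  obtain ⟨h1, h2, -⟩ := hs.isUp hw hk (astInvariant hw hk.le)
  simp only at hr
  exact ⟨(isUp_iff_RSKD hr.1 (by omega)).1 h1, (isUp_iff_RSKD (by omega) hr.2.2).2 h2⟩

lemma AST_Exc_mem (hπ : π ∈ perms321 n) : AST n (Exc π) ∈ ncMatchings n := by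
  rw [AST_Exc]
  exact ast_mem_ncMatchings (isWord321_letter hπ)

lemma RSKD_mem_dyckPaths (hπ : π ∈ perms321 n) : RSKD π ∈ dyckPaths n :=
  (labels_RSKD_AST hπ).mem_dyckPaths (AST_Exc_mem hπ) (RSKD_length π)

lemma Match_RSKD (hπ : π ∈ perms321 n) : Match (RSKD π) = AST n (Exc π) :=
  (labels_RSKD_AST hπ).Match_eq (AST_Exc_mem hπ) (RSKD_length π)

lemma Exc_eq_of_AST_eq (hπ : π ∈ perms321 n) (hσ : σ ∈ perms321 n)
    (h : AST n (Exc π) = AST n (Exc σ)) : Exc π = Exc σ := by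
  have hp := isWord321_letter hπ
  have hq := isWord321_letter hσ
  rw [AST_Exc, AST_Exc] at h
  have key : ∀ m, m ≤ n → ∀ j, 1 ≤ j → j ≤ m →
      (j < letter π j ↔ j < letter σ j) ∧ (j < letter π j → letter π j = letter σ j) := by
    intro m hm
    induction m with
    | zero => intro j h1 h2; omega
    | succ m ih =>
      have ih := ih (by omega)
      intro j h1 h2
      rcases h2.eq_or_lt with rfl | h2
      · have a : m + 1 < letter π (m + 1) → ¬ letter σ (m + 1) < letter π (m + 1) :=
          fun he hlt => ast_ne_of_lt hp hq hm ih he hlt h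
        have b : m + 1 < letter σ (m + 1) → ¬ letter π (m + 1) < letter σ (m + 1) :=
          fun he hlt => ast_ne_of_lt hq hp hm
          (fun j h1 h2 => ⟨(ih j h1 h2).1.symm, fun h =>
            ((ih j h1 h2).2 ((ih j h1 h2).1.2 h)).symm⟩)
          he hlt h.symm
        omega
      · exact ih j h1 (by omega)
  rw [Exc_eq_iff]
  intro i
  have := key n le_rfl (i + 1) (by omega) (by omega)
  rw [letter_succ, letter_succ] at this
  rw [Fin.lt_def, Fin.lt_def, Fin.ext_iff]
  omega

lemma RSKD_bijOn (n : ℕ) : Set.BijOn (RSKD (n := n)) (perms321 n) (dyckPaths n) := by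
  have hmaps : Set.MapsTo (RSKD (n := n)) (perms321 n) (dyckPaths n) := fun π hπ =>
    RSKD_mem_dyckPaths hπ
  have hinj : Set.InjOn (RSKD (n := n)) (perms321 n) := fun π hπ σ hσ h =>
    Exc_injOn n hπ hσ (Exc_eq_of_AST_eq hπ hσ (by rw [← Match_RSKD hπ, ← Match_RSKD hσ, h]))
  have hfin : (dyckPaths n).Finite := by
    have : Finite DyckStep :=
      Finite.of_injective (· = DyckStep.U) fun a b h => by cases a <;> cases b <;> simp_all
    refine Set.Finite.subset (List.finite_length_eq DyckStep (2 * n)) fun w hw => ?_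
    exact (mem_dyckPaths.1 hw).1
  refine ⟨hmaps, hinj, ?_⟩
  have heq : RSKD '' perms321 n = dyckPaths n := by
    -- surjectivity by counting
    refine Set.eq_of_subset_of_ncard_le hmaps.image_subset ?_ hfin
    rw [hinj.ncard_image]
    exact ncard_dyckPaths_le n
  exact heq.ge

lemma AST_bijOn (n : ℕ) : Set.BijOn (AST n) (antichains (n - 1)) (ncMatchings n) := by
  have hcomp : Set.BijOn (Match ∘ RSKD) (perms321 n) (ncMatchings n) :=
    (Match_bijOn n).comp (RSKD_bijOn n)
  refine ⟨fun A hA => ?_, fun A hA B hB h => ?_, fun M hM => ?_⟩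
  · obtain ⟨π, hπ, rfl⟩ := Exc_surjOn n hA
    exact AST_Exc_mem hπ
  · obtain ⟨π, hπ, rfl⟩ := Exc_surjOn n hA
    obtain ⟨σ, hσ, rfl⟩ := Exc_surjOn n hB
    exact Exc_eq_of_AST_eq hπ hσ h
  · obtain ⟨π, hπ, rfl⟩ := hcomp.surjOn hM
    exact ⟨Exc π, Exc_mem_antichains hπ, (Match_RSKD hπ).symm⟩

end Bijections

end ASTConnection

/-- In type `A`, the maps `Exc`, `RSKD`, `Match` and `AST` are bijections between the sets of
321-avoiding permutations, antichains of the positive root poset, Dyck paths and noncrossing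
matchings, and `AST = Match ∘ RSKD ∘ Exc⁻¹`. -/
theorem theorem5p2 (n : ℕ) :
    Set.BijOn ASTConnection.Exc (ASTConnection.perms321 n) (ASTConnection.antichains (n - 1)) ∧
    Set.BijOn ASTConnection.RSKD (ASTConnection.perms321 n) (ASTConnection.dyckPaths n) ∧
    Set.BijOn ASTConnection.Match (ASTConnection.dyckPaths n) (ASTConnection.ncMatchings n) ∧
    Set.BijOn (ASTConnection.AST n) (ASTConnection.antichains (n - 1))
      (ASTConnection.ncMatchings n) ∧
    Set.EqOn (ASTConnection.AST n)
      (ASTConnection.Match ∘ ASTConnection.RSKD ∘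
        Function.invFunOn ASTConnection.Exc (ASTConnection.perms321 n))
      (ASTConnection.antichains (n - 1)) := by
  refine ⟨ASTConnection.Exc_bijOn n, ASTConnection.RSKD_bijOn n, ASTConnection.Match_bijOn n,
    ASTConnection.AST_bijOn n, fun A hA => ?_⟩
  have hex : ∃ π ∈ ASTConnection.perms321 n, ASTConnection.Exc π = A :=
    ASTConnection.Exc_surjOn n hA
  have hmem := Function.invFunOn_mem hex
  have heq := Function.invFunOn_eq hex
  rw [Function.comp_apply, Function.comp_apply, ASTConnection.Match_RSKD hmem, heq]
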